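/- **Theorem.** There are absolute constants $A,B,K>0$ and $k\in\mathbb N$ such that the following holds for all $n\ge 1$, all $d$, all points $c_1,\dots,c_n\in\mathbb R^d$ (with the $\ell_2$ metric; repetitions allowed) and all $0<\epsilon<1/4$, $0<\delta<1$. Put $T=\lceil A\log(n/\delta)/(\epsilon^4\delta^2)\rceil$ and $m=\lceil B\log(n/\delta)/(\epsilon^2\delta^2)\rceil$. *Preprocessing.* For $b\in[d]$ let $p^{(b)}=\max\{|c_i^{(b)}-c_j^{(b)}|^2/\|c_i-c_j\|_2^2 : c_i\ne c_j\}$ (and $p^{(b)}=0$ if all points coincide). Start with the empty multiset $I$; in each of $T$ rounds, add each coordinate $b\in[d]$ to $I$ independently with probability $p^{(b)}$. Let $r_i\in\mathbb R^I$ be given by $r_i^{(b)}=c_i^{(b)}/\sqrt{p^{(b)}}$ for $b\in I$, and let $M\in\mathbb R^{[m]\times I}$ have independent entries, uniform in $\{\pm\sqrt{1/m}\}$. Store $I$, $\{p^{(b)}: b\in I\}$, $M$ and $Mr_1,\dots,Mr_n$. *Query.* Given $q\in\mathbb R^d$, read $q^{(b)}$ for $b\in I$, let $u^{(b)}=q^{(b)}/\sqrt{p^{(b)}}$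 for $b\in I$, and return an index $i\in[n]$ minimizing $\|Mr_i-Mu\|_2$ (the first one). Then, as a randomized algorithm on a real RAM (unit-cost arithmetic, comparisons and biased coin flips on real numbers), the preprocessing always takes at most $K\,(n+d+1/\epsilon+1/\delta)^k$ steps. Moreover, for every query point $q\in\mathbb R^d$, with probability at least $1-\delta$ over the random choices of the preprocessing, the following three conditions hold simultaneously: 1. the query reads at most $K\,n\log(n/\delta)/(\epsilon^4\delta^2)$ coordinates of $q$, counted with multiplicity; 2. the returned index $i\in[n]$ satisfies $\|q-c_i\|_2\le(1+\epsilon)\min_{j\in[n]}\|q-c_j\|_2$; 3. if $n,d\ge 2$, the stored data have size at most $K\,n\log^2(n/\delta)\log(d)/(\epsilon^6\delta^4)$ words, where a real number is one word and an element of $I$ is charged one word for each binary digit of $d$. -/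

import Mathlib

namespace SampleNN

noncomputable section

/-! ## Randomised real-RAM programs with step and probe counts -/

/-- One arithmetic instruction on real words. -/
inductive Instr : Type
  | add (x y : ℝ)
  | sub (x y : ℝ)
  | mul (x y : ℝ)
  | div (x y : ℝ)
  | max (x y : ℝ)
  | sqrt (x : ℝ)

/-- The result of an arithmetic instruction. -/
def Instr.value : Instr → ℝ
  | .add x y => x + y
  | .sub x y => x - y
  | .mul x y => x * y
  | .div x y => x / y
  | .max x y => Max.max x y
  | .sqrt x => Real.sqrt x

/-- Randomised real-RAM programs with output in `α`, whose input is a family of real numbers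
indexed by `ι`. The input is accessible only through `probe`; every constructor except `ret`
is one step. -/
inductive Prog (ι α : Type) : Type
  /-- stop with an output -/
  | ret (a : α)
  /-- read one real number of the input -/
  | probe (i : ι) (next : ℝ → Prog ι α)
  /-- perform one arithmetic instruction -/
  | arith (e : Instr) (next : ℝ → Prog ι α)
  /-- test whether `x ≤ y` -/
  | leq (x y : ℝ) (next : Bool → Prog ι α)
  /-- flip a coin, independent of everything else, that shows `true` with probability `p` -/
  | coin (p : ℝ) (next : Bool → Prog ι α)

namespace Prog

variable {ι α β : Type}

/-- Sequential composition. -/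
def bind : Prog ι α → (α → Prog ι β) → Prog ι β
  | ret a, f => f a
  | probe i next, f => probe i fun x => (next x).bind f
  | arith e next, f => arith e fun x => (next x).bind f
  | leq x y next, f => leq x y fun h => (next h).bind f
  | coin p next, f => coin p fun h => (next h).bind f

instance : Monad (Prog ι) where
  pure := ret
  bind := bind

/-- What is observed at the end of a run: the output, the number of steps performed, and how
many of these steps were probes of the input. -/
structure Outcome (α : Type) where
  value : α
  steps : ℕ
  probes : ℕ

/-- Add one step (not a probe) to an outcome. -/
def Outcome.step (o : Outcome α) : Outcome α := ⟨o.value, o.steps + 1, o.probes⟩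

/-- Add one step that is a probe to an outcome. -/
def Outcome.probeStep (o : Outcome α) : Outcome α := ⟨o.value, o.steps + 1, o.probes + 1⟩

set_option linter.deprecated false in
/-- The law of a coin of bias `p` (cut off to `[0,1]`). -/
def coinLaw (p : ℝ) : PMF Bool :=
  PMF.bernoulli (min p.toNNReal 1) (min_le_right _ _)

/-- The law of the outcome of a program on the input `x`. -/
def run (x : ι → ℝ) : Prog ι α → PMF (Outcome α)
  | ret a => PMF.pure ⟨a, 0, 0⟩
  | probe i next => ((next (x i)).run x).map Outcome.probeStep
  | arith e next => ((next e.value).run x).map Outcome.step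
  | leq a b next => ((next (decide (a ≤ b))).run x).map Outcome.step
  | coin p next => (coinLaw p).bind fun h => ((next h).run x).map Outcome.step

/-- The single instructions as programs. -/
def readInput (i : ι) : Prog ι ℝ := probe i ret
def op (e : Instr) : Prog ι ℝ := arith e ret
def isLE (x y : ℝ) : Prog ι Bool := leq x y ret
def flip (p : ℝ) : Prog ι Bool := coin p ret

/-- Run `f 0`, `f 1`, …, `f (k - 1)` in this order and collect the outputs in a vector. -/
def tabulate : (k : ℕ) → (Fin k → Prog ι α) → Prog ι (Fin k → α)
  | 0, _ => pure Fin.elim0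
  | k + 1, f => do
    let a ← f 0
    let v ← tabulate k fun i => f i.succ
    pure (Fin.cons a v)

/-- The sum of the entries of a vector. -/
def total : (k : ℕ) → (Fin k → ℝ) → Prog ι ℝ
  | 0, _ => pure 0
  | k + 1, v => do
    let s ← total k fun i => v i.succ
    op (.add (v 0) s)

/-- The maximum of `0` and the entries of a vector. -/
def maximum : (k : ℕ) → (Fin k → ℝ) → Prog ι ℝ
  | 0, _ => pure 0
  | k + 1, v => do
    let s ← maximum k fun i => v i.succ
    op (.max (v 0) s)

/-- The matrix-vector product `M v`. -/
def mulVec {m k : ℕ} (M : Matrix (Fin m) (Fin k) ℝ) (v : Fin k → ℝ) : Prog ι (Fin m → ℝ) :=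
  tabulate m fun l => do
    let w ← tabulate k fun j => op (.mul (M l j) (v j))
    total k w

/-- An index at which the vector `v` is minimal (the first one). -/
def argmin {n : ℕ} [NeZero n] (v : Fin n → ℝ) : Prog ι (Fin n) :=
  (List.finRange n).foldlM
    (fun best i => do
      let keep ← isLE (v best) (v i)
      pure (if keep then best else i))
    0

end Prog

open Prog

/-! ## The data structure -/

/-- The stored data: a multiset `I` of sampled coordinates (listed with repetitions), the
probabilities `p⁽ᵇ⁾` of its members, a matrix `M` whose columns are indexed by the members of
`I`, and the images under `M` of the `n` rescaled restricted points. -/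
structure DataStructure (n d m : ℕ) where
  size : ℕ
  coord : Fin size → Fin d
  prob : Fin size → ℝ
  matrix : Matrix (Fin m) (Fin size) ℝ
  sketch : Fin n → Fin m → ℝ

/-- The size in words. A real number takes one word; an index of a coordinate is charged
one word for each binary digit of `d`. -/
def DataStructure.words {n d m : ℕ} (D : DataStructure n d m) : ℕ :=
  D.size * Nat.size d + D.size + m * D.size + n * m

/-- The squared distances `‖c_i - c_j‖₂²` between the input points. -/
def squaredDistances (n d : ℕ) : Prog (Fin n × Fin d) (Fin n → Fin n → ℝ) :=
  tabulate n fun i => tabulate n fun j => do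
    let w ← tabulate d fun b => do
      let x ← readInput (i, b)
      let y ← readInput (j, b)
      let z ← op (.sub x y)
      op (.mul z z)
    total d w

/-- The sampling probabilities `p⁽ᵇ⁾`: the maximum of `|c_i⁽ᵇ⁾ - c_j⁽ᵇ⁾|² / ‖c_i - c_j‖₂²` over
the pairs with `c_i ≠ c_j` (and `0` if there is no such pair). -/
def probabilities (n d : ℕ) : Prog (Fin n × Fin d) (Fin d → ℝ) := do
  let D ← squaredDistances n d
  tabulate d fun b => do
    let v ← tabulate n fun i => do
      let w ← tabulate n fun j => do
        let degenerate ← isLE (D i j) 0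
        if degenerate then pure 0 else do
          let x ← readInput (i, b)
          let y ← readInput (j, b)
          let z ← op (.sub x y)
          let s ← op (.mul z z)
          op (.div s (D i j))
      maximum n w
    maximum n v

/-- `T` rounds, in each of which every coordinate `b` is added to the multiset `I`
with probability `p b`. -/
def sampleCoordinates {ι : Type} {d : ℕ} (T : ℕ) (p : Fin d → ℝ) : Prog ι (List (Fin d)) := do
  let chosen ← tabulate T fun _ => tabulate d fun b => flip (p b)
  pure ((List.finRange T).flatMap fun t => (List.finRange d).filter fun b => chosen t b)

/-- An `m × k` matrix with independent entries uniform in `{√(1/m), -√(1/m)}`. -/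
def signMatrix {ι : Type} (m k : ℕ) : Prog ι (Matrix (Fin m) (Fin k) ℝ) :=
  tabulate m fun _ => tabulate k fun _ => do
    let h ← flip (1 / 2)
    let a ← op (.div 1 m)
    let s ← op (.sqrt a)
    if h then pure s else op (.sub 0 s)

/-- The preprocessing algorithm, with `T` sampling rounds and target dimension `m`. -/
def preprocess (n d T m : ℕ) : Prog (Fin n × Fin d) (DataStructure n d m) := do
  let p ← probabilities n d
  let I ← sampleCoordinates T p
  let r ← tabulate n fun i => tabulate I.length fun k => do
    let x ← readInput (i, I.get k)
    let s ← op (.sqrt (p (I.get k)))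
    op (.div x s)
  let M ← signMatrix m I.length
  let Mr ← tabulate n fun i => mulVec M (r i)
  pure ⟨I.length, I.get, fun k => p (I.get k), M, Mr⟩

/-- The query algorithm; its input is the query point. -/
def query {n d m : ℕ} [NeZero n] (D : DataStructure n d m) : Prog (Fin d) (Fin n) := do
  let u ← tabulate D.size fun k => do
    let x ← readInput (D.coord k)
    let s ← op (.sqrt (D.prob k))
    op (.div x s)
  let Mu ← mulVec D.matrix u
  let dist ← tabulate n fun i => do
    let w ← tabulate m fun l => do
      let z ← op (.sub (D.sketch i l) (Mu l))
      op (.mul z z)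
    let s ← total m w
    op (.sqrt s)
  argmin dist

/-- The law of the outcome of the preprocessing of the points `c`. -/
def preprocessLaw {n d : ℕ} (T m : ℕ) (c : Fin n → EuclideanSpace ℝ (Fin d)) :
    PMF (Outcome (DataStructure n d m)) :=
  (preprocess n d T m).run fun ib => c ib.1 ib.2

/-- The joint law of the data structure built for the points `c` and of the outcome of the
query `q` to it. -/
def experiment {n d : ℕ} [NeZero n] (T m : ℕ) (c : Fin n → EuclideanSpace ℝ (Fin d))
    (q : EuclideanSpace ℝ (Fin d)) : PMF (DataStructure n d m × Outcome (Fin n)) :=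
  (preprocessLaw T m c).bind fun o =>
    ((query o.value).run fun b => q b).map fun r => (o.value, r)

/-- The number `T` of sampling rounds, with leading constant `A`. -/
def rounds (A : ℝ) (n : ℕ) (ε δ : ℝ) : ℕ := ⌈A * Real.log (n / δ) / (ε ^ 4 * δ ^ 2)⌉₊

/-- The target dimension `m`, with leading constant `B`. -/
def targetDim (B : ℝ) (n : ℕ) (ε δ : ℝ) : ℕ := ⌈B * Real.log (n / δ) / (ε ^ 2 * δ ^ 2)⌉₊

/-- `c i` is an `α`-approximate nearest neighbour of `q` among the points `c`. -/
def IsApproxNearest {n d : ℕ} (α : ℝ) (c : Fin n → EuclideanSpace ℝ (Fin d))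
    (q : EuclideanSpace ℝ (Fin d)) (i : Fin n) : Prop :=
  ∀ j, dist q (c i) ≤ α * dist q (c j)

end

end SampleNN

namespace SampleNN

open Prog

noncomputable section

/-! Fix `q`, let `c i₀` be a nearest point and put `a = c i₀ - q`. For a point `c j` with `‖c j - q‖
> (1 + ε)‖a‖` put `v = c j - c i₀`, `V = ‖v‖²` and `Δ = ‖c j - q‖² - ‖a‖² = ∑ (2 a_b v_b + v_b²)`.
It suffices that every such far point gets a strictly larger estimate than `c i₀`, so no distance
has to be estimated accurately.

Sampling. Each `p b` is at most a leverage score of the span of the points, so `∑ p b ≤ n`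
(`sum_sampleProb_le`), and a Chernoff bound keeps the sample below `3Tn` (`size_tail`). By
construction `v_b² ≤ p b * V`, so the part of `Δ` that involves only `v` is tame under sampling with
weights `1 / p b`. Nothing of the kind holds for `a`, because `q` is arbitrary. The sampled value
`P` of `‖a‖²` is therefore bounded only by Markov, within a factor `8 / δ` of its scale
(`sampled_norm_tail`); this is the source of the polynomial dependence on `1 / δ`. To control the
mixed terms `2 a_b v_b / p b`, the penalty `κ a_b² / p b` with `κ = εδ/16` is added to each summand.
It absorbs precisely the large negative values, so an exponential lower tail holds although the
summands are not bounded (`coordinate_bound`, `gap_tail`). By the Markov bound the penalty costs at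
most a quarter of `TΔ`, so the sampled squared norm of `c j - q` exceeds `P` by the factor `1 +
εδ/8` (`gap_sampled`).

Projection. A random sign matrix preserves each squared norm up to `1 ± θ` outside probability
`exp(-mθ²/32)` (`sign_tail`). With `θ = εδ/32` the order of norms that differ by the factor `1 +
εδ/8` survives for all far points together (`sign_compare`).

The programs are first replaced by explicit laws: given its coins the preprocessing is
deterministic, and so is the query, which probes once per sampled coordinate. Probes and storage are
thus controlled by the sample size, whereas the time bound holds on every run by counting
instructions. -/

/-- The law of a vector with independent entries. -/
def indep {α : Type} : (k : ℕ) → (Fin k → PMF α) → PMF (Fin k → α)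
  | 0, _ => PMF.pure Fin.elim0
  | k + 1, f => (f 0).bind fun a => (indep k fun i => f i.succ).map (Fin.cons a)

/-! ### Semantics of programs: output laws and deterministic runs -/

namespace Prog

variable {ι α β : Type}

/-- Outcome of a sequential composition. -/
def Outcome.append (o : Outcome α) (o' : Outcome β) : Outcome β :=
  ⟨o'.value, o.steps + o'.steps, o.probes + o'.probes⟩

theorem Outcome.step_append (o : Outcome α) :
    Outcome.append (β := β) o.step = Outcome.step ∘ Outcome.append o := by
  funext o'
  simp only [Outcome.append, Outcome.step, Function.comp, Outcome.mk.injEq, true_and, and_true]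
  omega

theorem Outcome.probeStep_append (o : Outcome α) :
    Outcome.append (β := β) o.probeStep = Outcome.probeStep ∘ Outcome.append o := by
  funext o'
  simp only [Outcome.append, Outcome.probeStep, Function.comp, Outcome.mk.injEq, true_and]
  omega

theorem run_bind (x : ι → ℝ) (p : Prog ι α) (f : α → Prog ι β) :
    (p.bind f).run x =
      (p.run x).bind fun o => ((f o.value).run x).map (Outcome.append o) := by
  induction p with
  | ret a =>
    simp only [Prog.bind, run, PMF.pure_bind]
    conv_lhs => rw [← PMF.map_id ((f a).run x)]
    congr 1
    funext o
    simp [Outcome.append]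
  | probe i next ih =>
    simp only [Prog.bind, run, ih, PMF.map_bind, PMF.bind_map, PMF.map_comp]
    congr 1; funext o
    simp only [Function.comp_apply, Outcome.probeStep_append]
    rfl
  | arith e next ih =>
    simp only [Prog.bind, run, ih, PMF.map_bind, PMF.bind_map, PMF.map_comp]
    congr 1; funext o
    simp only [Function.comp_apply, Outcome.step_append]
    rfl
  | leq a b next ih =>
    simp only [Prog.bind, run, ih, PMF.map_bind, PMF.bind_map, PMF.map_comp]
    congr 1; funext o
    simp only [Function.comp_apply, Outcome.step_append]
    rfl
  | coin p next ih =>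
    simp only [Prog.bind, run, ih, PMF.map_bind, PMF.bind_map, PMF.bind_bind, PMF.map_comp]
    congr 1; funext h; congr 1; funext o
    simp only [Function.comp_apply, Outcome.step_append]
    rfl

/-- The law of the output of a program. -/
def val (x : ι → ℝ) (p : Prog ι α) : PMF α := (p.run x).map Outcome.value

theorem val_pure (x : ι → ℝ) (a : α) : val x (pure a : Prog ι α) = PMF.pure a := by
  change (PMF.pure _).map _ = _
  rw [PMF.pure_map]

theorem val_bind (x : ι → ℝ) (p : Prog ι α) (f : α → Prog ι β) :
    val x (p >>= f) = (val x p).bind fun a => val x (f a) := by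
  change (run x (p.bind f)).map _ = _
  simp only [val, run_bind, PMF.map_bind, PMF.bind_map, PMF.map_comp]
  rfl

theorem val_op (x : ι → ℝ) (e : Instr) : val x (op e) = PMF.pure e.value := by
  simp [val, op, run, PMF.pure_map, Outcome.step]

theorem val_flip (x : ι → ℝ) (p : ℝ) : val x (flip p) = coinLaw p := by
  simp only [val, flip, run, PMF.map_bind, PMF.pure_map, Outcome.step]
  exact PMF.bind_pure _

/-- Each coin is drawn afresh, so successive calls are independent; this is where product laws
enter. -/
theorem val_tabulate (x : ι → ℝ) (k : ℕ) (f : Fin k → Prog ι α) :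
    val x (tabulate k f) = indep k fun i => val x (f i) := by
  induction k with
  | zero => exact val_pure x _
  | succ k ih =>
    simp only [tabulate, val_bind, ih, val_pure, indep]
    rfl

/-- On the input `x` the program always outputs `a` and performs `r` probes. -/
def Det (x : ι → ℝ) (p : Prog ι α) (a : α) (r : ℕ) : Prop :=
  ∃ s, p.run x = PMF.pure ⟨a, s, r⟩

variable {x : ι → ℝ}

theorem Det.val {p : Prog ι α} {a : α} {r : ℕ} (h : Det x p a r) :
    p.val x = PMF.pure a := by
  obtain ⟨s, h⟩ := h
  rw [Prog.val, h, PMF.pure_map]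

theorem Det.pure (a : α) : Det x (pure a : Prog ι α) a 0 := ⟨0, rfl⟩

theorem Det.bind {p : Prog ι α} {f : α → Prog ι β} {a : α} {b : β} {r r' : ℕ}
    (hp : Det x p a r) (hf : Det x (f a) b r') : Det x (p >>= f) b (r + r') := by
  obtain ⟨s, hp⟩ := hp
  obtain ⟨s', hf⟩ := hf
  refine ⟨s + s', ?_⟩
  change (p.bind f).run x = _
  rw [run_bind, hp, PMF.pure_bind, hf, PMF.pure_map]
  rfl

theorem Det.bind_zero {p : Prog ι α} {f : α → Prog ι β} {a : α} {b : β} {r : ℕ}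
    (hp : Det x p a 0) (hf : Det x (f a) b r) : Det x (p >>= f) b r := by
  simpa using hp.bind hf

theorem Det.op (e : Instr) : Det x (op e : Prog ι ℝ) e.value 0 :=
  ⟨1, by simp [Prog.op, run, PMF.pure_map, Outcome.step]⟩

theorem Det.isLE (a b : ℝ) : Det x (isLE a b : Prog ι Bool) (decide (a ≤ b)) 0 :=
  ⟨1, by simp [Prog.isLE, run, PMF.pure_map, Outcome.step]⟩

theorem Det.readInput (i : ι) : Det x (readInput i) (x i) 1 :=
  ⟨1, by simp [Prog.readInput, run, PMF.pure_map, Outcome.probeStep]⟩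

theorem Det.tabulate {k : ℕ} {f : Fin k → Prog ι α} {a : Fin k → α} {r : Fin k → ℕ}
    (h : ∀ i, Det x (f i) (a i) (r i)) : Det x (tabulate k f) a (∑ i, r i) := by
  induction k with
  | zero =>
    have : a = Fin.elim0 := Subsingleton.elim _ _
    subst this
    exact Det.pure _
  | succ k ih =>
    rw [Fin.sum_univ_succ, ← Fin.cons_self_tail a]
    refine (h 0).bind ?_
    rw [← add_zero (∑ i : Fin k, r i.succ)]
    exact (ih fun i => h i.succ).bind (Det.pure _)

theorem Det.tabulate_zero {k : ℕ} {f : Fin k → Prog ι α} {a : Fin k → α}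
    (h : ∀ i, Det x (f i) (a i) 0) : Det x (Prog.tabulate k f) a 0 := by
  simpa using Det.tabulate h

theorem Det.total (k : ℕ) (v : Fin k → ℝ) : Det x (total k v : Prog ι ℝ) (∑ i, v i) 0 := by
  induction k with
  | zero => rw [Finset.univ_eq_empty, Finset.sum_empty]; exact Det.pure (0 : ℝ)
  | succ k ih =>
    rw [Fin.sum_univ_succ]
    exact (ih _).bind_zero (Det.op (.add _ _))

end Prog

/-- The maximum of `0` and the entries of a vector. -/
def maxZero : (k : ℕ) → (Fin k → ℝ) → ℝ
  | 0, _ => 0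
  | k + 1, v => max (v 0) (maxZero k fun i => v i.succ)

theorem maxZero_nonneg (k : ℕ) (v : Fin k → ℝ) : 0 ≤ maxZero k v := by
  induction k with
  | zero => exact le_rfl
  | succ k ih => exact (ih _).trans (le_max_right _ _)

theorem le_maxZero {k : ℕ} (v : Fin k → ℝ) (i : Fin k) : v i ≤ maxZero k v := by
  induction k with
  | zero => exact i.elim0
  | succ k ih =>
    refine Fin.cases (le_max_left _ _) (fun i => ?_) i
    exact (ih (fun i => v i.succ) i).trans (le_max_right _ _)

theorem maxZero_le {k : ℕ} {v : Fin k → ℝ} {M : ℝ} (hM : 0 ≤ M) (h : ∀ i, v i ≤ M) :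
    maxZero k v ≤ M := by
  induction k with
  | zero => exact hM
  | succ k ih => exact max_le (h 0) (ih fun i => h i.succ)

namespace Prog

variable {ι α β : Type} {x : ι → ℝ}

theorem Det.maximum (k : ℕ) (v : Fin k → ℝ) :
    Det x (maximum k v : Prog ι ℝ) (maxZero k v) 0 := by
  induction k with
  | zero => exact Det.pure (0 : ℝ)
  | succ k ih => exact (ih _).bind_zero (Det.op (.max _ _))

theorem Det.mulVec {m k : ℕ} (M : Matrix (Fin m) (Fin k) ℝ) (v : Fin k → ℝ) :
    Det x (mulVec M v : Prog ι _) (fun l => ∑ j, M l j * v j) 0 :=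
  Det.tabulate_zero fun _ =>
    (Det.tabulate_zero fun _ => Det.op (.mul _ _)).bind_zero (Det.total _ _)

theorem Det.foldl_argmin {n : ℕ} (v : Fin n → ℝ) (l : List (Fin n)) (a : Fin n) :
    ∃ b, Det x (l.foldlM (fun best i => do
        let keep ← Prog.isLE (v best) (v i)
        Pure.pure (if keep then best else i)) a : Prog ι (Fin n)) b 0 ∧
      v b ≤ v a ∧ ∀ i ∈ l, v b ≤ v i := by
  induction l generalizing a with
  | nil => exact ⟨a, Det.pure a, le_rfl, by simp⟩
  | cons i l ih =>
    obtain ⟨b, hb, hle, hl⟩ := ih (if decide (v a ≤ v i) then a else i)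
    refine ⟨b, ?_, ?_, ?_⟩
    · rw [List.foldlM_cons]
      exact ((Det.isLE _ _).bind_zero (Det.pure _)).bind_zero hb
    · refine hle.trans ?_
      by_cases h : v a ≤ v i <;> simp [h]
      exact (not_le.mp h).le
    · simp only [List.mem_cons, forall_eq_or_imp]
      refine ⟨hle.trans ?_, hl⟩
      by_cases h : v a ≤ v i <;> simp [h]

theorem Det.argmin {n : ℕ} [NeZero n] (v : Fin n → ℝ) :
    ∃ b, Det x (argmin v : Prog ι (Fin n)) b 0 ∧ ∀ i, v b ≤ v i := by
  obtain ⟨b, hb, -, hl⟩ := Det.foldl_argmin (x := x) v (List.finRange n) 0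
  exact ⟨b, hb, fun i => hl i (List.mem_finRange i)⟩

/-! ### Step bounds valid on every run -/

/-- Every run of the program on the input `x` takes at most `N` steps and has an output
satisfying `Q`. -/
def Spec (x : ι → ℝ) (p : Prog ι α) (N : ℕ) (Q : α → Prop) : Prop :=
  ∀ o ∈ (p.run x).support, o.steps ≤ N ∧ Q o.value

theorem Spec.mono {p : Prog ι α} {N N' : ℕ} {Q Q' : α → Prop} (h : Spec x p N Q)
    (hN : N ≤ N') (hQ : ∀ a, Q a → Q' a) : Spec x p N' Q' :=
  fun o ho => ⟨(h o ho).1.trans hN, hQ _ (h o ho).2⟩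

theorem Spec.pure {a : α} {Q : α → Prop} (h : Q a) : Spec x (pure a : Prog ι α) 0 Q := by
  intro o ho
  replace ho : o ∈ (PMF.pure (⟨a, 0, 0⟩ : Outcome α)).support := ho
  rw [PMF.support_pure, Set.mem_singleton_iff] at ho
  subst ho
  exact ⟨le_rfl, h⟩

theorem Spec.bind {p : Prog ι α} {f : α → Prog ι β} {N N' : ℕ} {Q : α → Prop}
    {R : β → Prop} (hp : Spec x p N Q) (hf : ∀ a, Q a → Spec x (f a) N' R) :
    Spec x (p >>= f) (N + N') R := by
  intro o ho
  replace ho : o ∈ ((p.bind f).run x).support := ho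
  rw [run_bind] at ho
  obtain ⟨o₁, h₁, ho⟩ := (PMF.mem_support_bind_iff _ _ _).1 ho
  obtain ⟨o₂, h₂, rfl⟩ := (PMF.mem_support_map_iff _ _ _).1 ho
  obtain ⟨hN, hQ⟩ := hp o₁ h₁
  obtain ⟨hN', hR⟩ := hf _ hQ o₂ h₂
  exact ⟨Nat.add_le_add hN hN', hR⟩

theorem Spec.op (e : Instr) : Spec x (op e : Prog ι ℝ) 1 fun _ => True := by
  intro o ho
  simp only [Prog.op, run, PMF.pure_map, PMF.support_pure, Set.mem_singleton_iff] at ho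
  subst ho
  exact ⟨le_rfl, trivial⟩

theorem Spec.isLE (a b : ℝ) : Spec x (isLE a b : Prog ι Bool) 1 fun _ => True := by
  intro o ho
  simp only [Prog.isLE, run, PMF.pure_map, PMF.support_pure, Set.mem_singleton_iff] at ho
  subst ho
  exact ⟨le_rfl, trivial⟩

theorem Spec.readInput (i : ι) : Spec x (readInput i) 1 fun _ => True := by
  intro o ho
  simp only [Prog.readInput, run, PMF.pure_map, PMF.support_pure,
    Set.mem_singleton_iff] at ho
  subst ho
  exact ⟨le_rfl, trivial⟩

theorem Spec.flip (p : ℝ) : Spec x (flip p : Prog ι Bool) 1 fun _ => True := by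
  intro o ho
  simp only [Prog.flip, run, PMF.pure_map] at ho
  obtain ⟨h, -, ho⟩ := (PMF.mem_support_bind_iff _ _ _).1 ho
  rw [PMF.support_pure, Set.mem_singleton_iff] at ho
  subst ho
  exact ⟨le_rfl, trivial⟩

theorem Spec.tabulate {k N : ℕ} {f : Fin k → Prog ι α}
    (h : ∀ i, Spec x (f i) N fun _ => True) :
    Spec x (tabulate k f) (k * N) fun _ => True := by
  induction k with
  | zero => rw [Nat.zero_mul]; exact Spec.pure trivial
  | succ k ih =>
    refine Spec.mono ((h 0).bind fun a _ => (ih fun i => h i.succ).bind fun v _ =>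
      Spec.pure trivial) ?_ fun _ => id
    rw [Nat.succ_mul]; omega

theorem Spec.total (k : ℕ) (v : Fin k → ℝ) :
    Spec x (total k v : Prog ι ℝ) k fun _ => True := by
  induction k with
  | zero => exact Spec.pure trivial
  | succ k ih => exact (ih _).bind fun _ _ => Spec.op _

theorem Spec.maximum (k : ℕ) (v : Fin k → ℝ) :
    Spec x (maximum k v : Prog ι ℝ) k fun _ => True := by
  induction k with
  | zero => exact Spec.pure trivial
  | succ k ih => exact (ih _).bind fun _ _ => Spec.op _

theorem Spec.mulVec {m k : ℕ} (M : Matrix (Fin m) (Fin k) ℝ) (v : Fin k → ℝ) :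
    Spec x (mulVec M v : Prog ι _) (m * (k + k)) fun _ => True :=
  Spec.tabulate fun _ =>
    ((Spec.tabulate fun _ => Spec.op _).bind fun _ _ => Spec.total _ _).mono
      (by simp) fun _ => id

end Prog

/-! ### Expectations, product laws and failure probabilities -/

/-- The expectation of a real function under a law on a finite type. -/
def mean {Ω : Type} [Fintype Ω] (μ : PMF Ω) (f : Ω → ℝ) : ℝ := ∑ ω, (μ ω).toReal * f ω

section Mean

variable {Ω : Type} [Fintype Ω] (μ : PMF Ω)

theorem mean_mono {f g : Ω → ℝ} (h : ∀ ω, f ω ≤ g ω) : mean μ f ≤ mean μ g :=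
  Finset.sum_le_sum fun ω _ => mul_le_mul_of_nonneg_left (h ω) ENNReal.toReal_nonneg

theorem mean_const_mul (a : ℝ) (f : Ω → ℝ) : mean μ (fun ω => a * f ω) = a * mean μ f := by
  simp only [mean, Finset.mul_sum]
  exact Finset.sum_congr rfl fun _ _ => by ring

theorem mean_sum {κ : Type} (s : Finset κ) (f : κ → Ω → ℝ) :
    mean μ (fun ω => ∑ k ∈ s, f k ω) = ∑ k ∈ s, mean μ (f k) := by
  simp only [mean, Finset.mul_sum]
  exact Finset.sum_comm

theorem mean_one : mean μ (fun _ => 1) = 1 := by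
  simp only [mean, mul_one]
  have h := μ.tsum_coe
  rw [tsum_fintype] at h
  rw [← ENNReal.toReal_sum fun ω _ => μ.apply_ne_top ω, h, ENNReal.toReal_one]

theorem mean_nonneg {f : Ω → ℝ} (h : ∀ ω, 0 ≤ f ω) : 0 ≤ mean μ f :=
  Finset.sum_nonneg fun ω _ => mul_nonneg ENNReal.toReal_nonneg (h ω)

/-- Markov's inequality. -/
theorem toOuterMeasure_le_mean {s : Set Ω} {f : Ω → ℝ} (h0 : ∀ ω, 0 ≤ f ω)
    (h1 : ∀ ω ∈ s, 1 ≤ f ω) : μ.toOuterMeasure s ≤ ENNReal.ofReal (mean μ f) := by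
  classical
  rw [PMF.toOuterMeasure_apply, tsum_fintype, mean,
    ENNReal.ofReal_sum_of_nonneg fun ω _ => mul_nonneg ENNReal.toReal_nonneg (h0 ω)]
  refine Finset.sum_le_sum fun ω _ => ?_
  by_cases hω : ω ∈ s
  · rw [Set.indicator_of_mem hω, ENNReal.ofReal_mul ENNReal.toReal_nonneg,
      ENNReal.ofReal_toReal (μ.apply_ne_top ω)]
    exact le_mul_of_one_le_right zero_le (by simpa using h1 ω hω)
  · simp [Set.indicator_of_notMem hω]

end Mean

theorem indep_apply {α : Type} {k : ℕ} (f : Fin k → PMF α) (v : Fin k → α) :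
    indep k f v = ∏ i, f i (v i) := by
  classical
  induction k with
  | zero =>
    have : v = Fin.elim0 := Subsingleton.elim _ _
    subst this
    simp [indep]
  | succ k ih =>
    rw [Fin.prod_univ_succ, indep, PMF.bind_apply, tsum_eq_single (v 0)]
    · congr 1
      rw [PMF.map_apply, tsum_eq_single (Fin.tail v)]
      · rw [if_pos (Fin.cons_self_tail v).symm, ih]
        rfl
      · intro w hw
        rw [if_neg]
        intro h
        exact hw (by rw [h, Fin.tail_cons])
    · intro a ha
      rw [mul_eq_zero]
      right
      rw [PMF.map_apply, ENNReal.tsum_eq_zero]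
      intro w
      rw [if_neg]
      intro h
      exact ha (by rw [h, Fin.cons_zero])

/-- Expanding `∏ i, ∑ a` gives the sum over all vectors. Every exponential moment below is factored
this way. -/
theorem mean_indep_prod {α : Type} [Fintype α] {k : ℕ} (f : Fin k → PMF α)
    (g : Fin k → α → ℝ) :
    mean (indep k f) (fun v => ∏ i, g i (v i)) = ∏ i, mean (f i) (g i) := by
  classical
  simp only [mean, indep_apply, ENNReal.toReal_prod, ← Finset.prod_mul_distrib]
  rw [Finset.prod_univ_sum, Fintype.piFinset_univ]

theorem mean_indep_single {α : Type} [Fintype α] {k : ℕ} (f : Fin k → PMF α)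
    (i : Fin k) (g : α → ℝ) :
    mean (indep k f) (fun v => g (v i)) = mean (f i) g := by
  classical
  have h := mean_indep_prod f fun j a => if j = i then g a else 1
  simp only [Finset.prod_ite_eq', Finset.mem_univ, if_true] at h
  rw [h, Finset.prod_eq_single i]
  · simp
  · intro j _ hj
    simp [hj, mean_one]
  · simp

theorem mean_indep_succ {α : Type} [Fintype α] {k : ℕ} (f : Fin (k + 1) → PMF α)
    (g : (Fin (k + 1) → α) → ℝ) :
    mean (indep (k + 1) f) g =
      mean (f 0) fun a => mean (indep k fun i => f i.succ) fun v => g (Fin.cons a v) := by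
  simp only [mean, indep_apply, Finset.mul_sum, Fin.prod_univ_succ, ENNReal.toReal_mul]
  rw [← (Fin.consEquiv fun _ => α).sum_comp, Fintype.sum_prod_type]
  simp [Fin.consEquiv, mul_assoc]

theorem indep_map {α β : Type} (g : α → β) {k : ℕ} (f : Fin k → PMF α) :
    indep k (fun i => (f i).map g) = (indep k f).map fun v i => g (v i) := by
  induction k with
  | zero =>
    simp only [indep, PMF.pure_map]
    congr 1
    exact Subsingleton.elim _ _
  | succ k ih =>
    simp only [indep, ih, PMF.map_bind, PMF.bind_map, PMF.map_comp]
    congr 1; funext a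
    simp only [Function.comp_apply]
    congr 1; funext v i
    refine Fin.cases rfl (fun i => rfl) i

set_option linter.deprecated false in
theorem coinLaw_apply {p : ℝ} (h0 : 0 ≤ p) (h1 : p ≤ 1) (b : Bool) :
    coinLaw p b = ENNReal.ofReal (if b then p else 1 - p) := by
  have : min p.toNNReal 1 = p.toNNReal := min_eq_left (by simpa using h1)
  cases b
  · have h := ENNReal.ofReal_sub 1 h0
    rw [ENNReal.ofReal_one] at h
    simpa [coinLaw, PMF.bernoulli_apply, this, ENNReal.ofReal] using h.symm
  · simp [coinLaw, PMF.bernoulli_apply, this, ENNReal.ofReal]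

theorem mean_coinLaw {p : ℝ} (h0 : 0 ≤ p) (h1 : p ≤ 1) (g : Bool → ℝ) :
    mean (coinLaw p) g = p * g true + (1 - p) * g false := by
  simp [mean, coinLaw_apply h0 h1, ENNReal.toReal_ofReal h0,
    ENNReal.toReal_ofReal (sub_nonneg.2 h1)]

/-- Failures of a two-stage experiment: either the first stage is bad, or the second fails after a
good first stage. It is used with the sampling coins as first stage and the sign coins as second. -/
theorem toOuterMeasure_bind_le {α β : Type} (μ : PMF α) (f : α → PMF β) {s : Set β}
    {bad : Set α} {a b : ENNReal} (hbad : μ.toOuterMeasure bad ≤ a)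
    (h : ∀ ω ∉ bad, (f ω).toOuterMeasure s ≤ b) :
    (μ.bind f).toOuterMeasure s ≤ a + b := by
  classical
  rw [PMF.toOuterMeasure_bind_apply]
  calc ∑' ω, μ ω * (f ω).toOuterMeasure s
      ≤ ∑' ω, (bad.indicator μ ω + μ ω * b) := by
        refine ENNReal.tsum_le_tsum fun ω => ?_
        by_cases hω : ω ∈ bad
        · rw [Set.indicator_of_mem hω]
          refine le_add_of_le_of_nonneg ?_ zero_le
          refine mul_le_of_le_one_right zero_le ?_
          exact ((f ω).toOuterMeasure.mono (Set.subset_univ s)).trans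
            ((PMF.toOuterMeasure_apply_eq_one_iff _ _).2 (Set.subset_univ _)).le
        · rw [Set.indicator_of_notMem hω, zero_add]
          gcongr
          exact h ω hω
    _ = μ.toOuterMeasure bad + b := by
        rw [ENNReal.tsum_add, ENNReal.tsum_mul_right, μ.tsum_coe, one_mul,
          PMF.toOuterMeasure_apply]
    _ ≤ a + b := by gcongr

theorem le_toOuterMeasure_of_compl {α : Type} (μ : PMF α) {s : Set α} {δ : ℝ}
    (h0 : 0 ≤ δ) (h : μ.toOuterMeasure sᶜ ≤ ENNReal.ofReal δ) :
    ENNReal.ofReal (1 - δ) ≤ μ.toOuterMeasure s := by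
  have h1 : (1 : ENNReal) ≤ μ.toOuterMeasure s + μ.toOuterMeasure sᶜ := by
    rw [← (PMF.toOuterMeasure_apply_eq_one_iff μ Set.univ).2 (Set.subset_univ _),
      ← Set.union_compl_self s]
    exact MeasureTheory.measure_union_le _ _
  rw [ENNReal.ofReal_sub _ h0, ENNReal.ofReal_one, tsub_le_iff_right]
  exact h1.trans (by gcongr)

/-! ### The law of the data structure in terms of its coins -/

section Values

variable {ι α : Type} (x : ι → ℝ)

theorem indep_pure {k : ℕ} (a : Fin k → α) :
    indep k (fun i => PMF.pure (a i)) = PMF.pure a := by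
  induction k with
  | zero => exact congrArg PMF.pure (Subsingleton.elim _ _)
  | succ k ih =>
    simp only [indep, PMF.pure_bind, ih, PMF.pure_map]
    exact congrArg PMF.pure (Fin.cons_self_tail a)

theorem val_readInput (i : ι) : val x (readInput i) = PMF.pure (x i) :=
  (Det.readInput i).val

theorem val_isLE (a b : ℝ) : val x (isLE a b : Prog ι Bool) = PMF.pure (decide (a ≤ b)) :=
  (Det.isLE a b).val

theorem val_total (k : ℕ) (v : Fin k → ℝ) :
    val x (total k v : Prog ι ℝ) = PMF.pure (∑ i, v i) :=
  (Det.total k v).val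

theorem val_maximum (k : ℕ) (v : Fin k → ℝ) :
    val x (maximum k v : Prog ι ℝ) = PMF.pure (maxZero k v) :=
  (Det.maximum k v).val

theorem val_mulVec {m k : ℕ} (M : Matrix (Fin m) (Fin k) ℝ) (v : Fin k → ℝ) :
    val x (mulVec M v : Prog ι _) = PMF.pure fun l => ∑ j, M l j * v j :=
  (Det.mulVec M v).val

end Values

variable {n d : ℕ}

/-- The squared distance of two input points. -/
def sqDist (x : Fin n × Fin d → ℝ) (i j : Fin n) : ℝ :=
  ∑ b, (x (i, b) - x (j, b)) * (x (i, b) - x (j, b))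

/-- The sampling probability of a coordinate. -/
def sampleProb (x : Fin n × Fin d → ℝ) (b : Fin d) : ℝ :=
  maxZero n fun i => maxZero n fun j =>
    if sqDist x i j ≤ 0 then 0
    else (x (i, b) - x (j, b)) * (x (i, b) - x (j, b)) / sqDist x i j

theorem val_probabilities (x : Fin n × Fin d → ℝ) :
    val x (probabilities n d) = PMF.pure (sampleProb x) := by
  have key : ∀ i j b, val x (if decide (sqDist x i j ≤ 0) = true then pure 0 else do
          let u ← readInput (i, b)
          let y ← readInput (j, b)
          let z ← op (.sub u y)
          let s ← op (.mul z z)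
          op (.div s (sqDist x i j)) : Prog (Fin n × Fin d) ℝ) =
      PMF.pure (if sqDist x i j ≤ 0 then 0
        else (x (i, b) - x (j, b)) * (x (i, b) - x (j, b)) / sqDist x i j) := by
    intro i j b
    by_cases h : sqDist x i j ≤ 0 <;>
      simp [h, val_bind, val_pure, val_readInput, val_op, PMF.pure_bind, Instr.value]
  have hD : val x (squaredDistances n d) = PMF.pure (sqDist x) := by
    simp only [squaredDistances, val_tabulate, val_bind, val_readInput, val_op, PMF.pure_bind,
      indep_pure, val_total, Instr.value]
    rfl
  simp only [probabilities, val_bind, hD, PMF.pure_bind, val_tabulate, val_isLE, key,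
    indep_pure, val_maximum]
  rfl

/-- The law of the coins flipped in the sampling rounds. -/
def roundsLaw (T : ℕ) (p : Fin d → ℝ) : PMF (Fin T → Fin d → Bool) :=
  indep T fun _ => indep d fun b => coinLaw (p b)

/-- The multiset of coordinates selected by the coins. -/
def selected {T : ℕ} (ch : Fin T → Fin d → Bool) : List (Fin d) :=
  (List.finRange T).flatMap fun t => (List.finRange d).filter fun b => ch t b

theorem sum_selected {T : ℕ} (ch : Fin T → Fin d → Bool) (g : Fin d → ℝ) :
    ∑ k, g ((selected ch).get k) = ∑ t, ∑ b, if ch t b then g b else 0 := by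
  have h1 : ∀ l : List (Fin d), ∑ k, g (l.get k) = (l.map g).sum := by
    intro l
    rw [← List.sum_ofFn]
    congr 1
    conv_rhs => rw [← List.ofFn_get l, List.map_ofFn]
    rfl
  have h2 : ∀ (l : List (Fin d)) (q : Fin d → Bool),
      ((l.filter q).map g).sum = (l.map fun b => if q b then g b else 0).sum := by
    intro l q
    induction l with
    | nil => rfl
    | cons b l ih => by_cases h : q b <;> simp [h, ih]
  have h3 : ∀ l : List (Fin T),
      ((l.flatMap fun t => (List.finRange d).filter fun b => ch t b).map g).sum =
        (l.map fun t => ((List.finRange d).map fun b => if ch t b then g b else 0).sum).sum := by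
    intro l
    induction l with
    | nil => rfl
    | cons t l ih => simp [ih, h2]
  rw [h1, selected, h3]
  simp [← List.ofFn_eq_map, List.sum_ofFn]

theorem val_sampleCoordinates {ι : Type} (x : ι → ℝ) (T : ℕ) (p : Fin d → ℝ) :
    val x (sampleCoordinates T p) = (roundsLaw T p).map selected := by
  simp only [sampleCoordinates, val_bind, val_tabulate, val_flip, val_pure]
  rfl

/-- The law of the coins flipped for the sign matrix. -/
def signsLaw (m k : ℕ) : PMF (Fin m → Fin k → Bool) :=
  indep m fun _ => indep k fun _ => coinLaw (1 / 2)

/-- The matrix with entries `±√(1/m)` described by the coins. -/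
def toSignMatrix {m k : ℕ} (s : Fin m → Fin k → Bool) : Matrix (Fin m) (Fin k) ℝ :=
  fun l j => if s l j then Real.sqrt (1 / m) else 0 - Real.sqrt (1 / m)

theorem val_signMatrix {ι : Type} (x : ι → ℝ) (m k : ℕ) :
    val x (signMatrix m k) = (signsLaw m k).map toSignMatrix := by
  have key : ∀ (h : Bool) (s : ℝ), val x (if h = true then pure s else op (.sub 0 s) :
      Prog ι ℝ) = PMF.pure (if h then s else 0 - s) := by
    intro h s
    cases h <;> simp [val_pure, val_op, Instr.value]
  have entry : val x (do
      let h ← Prog.flip (1 / 2)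
      let a ← op (.div 1 m)
      let s ← op (.sqrt a)
      if h then pure s else op (.sub 0 s) : Prog ι ℝ) =
      (coinLaw (1 / 2)).map
        fun h => if h then Real.sqrt (1 / m) else 0 - Real.sqrt (1 / m) := by
    simp only [val_bind, val_flip, val_op, PMF.pure_bind, key, Instr.value]
    rfl
  refine (val_tabulate x m _).trans ?_
  simp only [val_tabulate, entry, indep_map]
  rfl

/-- The data structure built from the outcomes of the coins. -/
def buildData (x : Fin n × Fin d → ℝ) {T m : ℕ} (ch : Fin T → Fin d → Bool)
    (s : Fin m → Fin (selected ch).length → Bool) : DataStructure n d m :=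
  ⟨(selected ch).length, (selected ch).get, fun k => sampleProb x ((selected ch).get k),
    toSignMatrix s, fun i l => ∑ j, toSignMatrix s l j *
      (x (i, (selected ch).get j) / Real.sqrt (sampleProb x ((selected ch).get j)))⟩

/-- Only the two groups of coins are random. The number of columns of the sign matrix depends on the
sample, so the law is a `bind` and not a product. -/
theorem val_preprocess (x : Fin n × Fin d → ℝ) (T m : ℕ) :
    val x (preprocess n d T m) = (roundsLaw T (sampleProb x)).bind fun ch =>
      (signsLaw m (selected ch).length).map (buildData x ch) := by
  simp only [preprocess, val_bind, val_probabilities, PMF.pure_bind, val_sampleCoordinates,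
    PMF.bind_map, val_tabulate, val_readInput, val_op, indep_pure, val_signMatrix, val_mulVec,
    val_pure, Instr.value]
  rfl

/-- The estimate of the squared distance between the query and a point. -/
def estimate {m : ℕ} (D : DataStructure n d m) (q : Fin d → ℝ) (i : Fin n) : ℝ :=
  ∑ l, (D.sketch i l - ∑ j, D.matrix l j * (q (D.coord j) / Real.sqrt (D.prob j))) ^ 2

theorem run_query {m : ℕ} [NeZero n] (D : DataStructure n d m) (q : Fin d → ℝ) :
    ∃ i, Det q (query D) i D.size ∧ ∀ j, estimate D q i ≤ estimate D q j := by
  obtain ⟨i, hi, hmin⟩ := Det.argmin (x := q) fun i => Real.sqrt (∑ l,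
    (D.sketch i l - ∑ j, D.matrix l j * (q (D.coord j) / Real.sqrt (D.prob j))) *
    (D.sketch i l - ∑ j, D.matrix l j * (q (D.coord j) / Real.sqrt (D.prob j))))
  refine ⟨i, ?_, fun j => ?_⟩
  · have hu : Det q (tabulate D.size fun k => do
        let x ← readInput (D.coord k)
        let s ← op (.sqrt (D.prob k))
        op (.div x s)) (fun k => q (D.coord k) / Real.sqrt (D.prob k)) D.size := by
      have h := Det.tabulate (x := q) (r := fun _ : Fin D.size => 1)
        (f := fun k => do
          let x ← readInput (D.coord k)
          let s ← op (.sqrt (D.prob k))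
          op (.div x s)) (a := fun k => q (D.coord k) / Real.sqrt (D.prob k)) ?_
      · simpa using h
      · intro k
        exact (Det.readInput (D.coord k)).bind (r' := 0)
          ((Det.op (.sqrt (D.prob k))).bind_zero (Det.op (.div _ _)))
    refine hu.bind (r' := 0) ((Det.mulVec _ _).bind_zero
      ((Det.tabulate_zero fun i => ?_).bind_zero hi))
    refine (Det.tabulate_zero (a := fun l => _ * _) fun l => ?_).bind_zero
      ((Det.total _ _).bind_zero (Det.op (.sqrt _)))
    exact (Det.op (.sub _ _)).bind_zero (Det.op (.mul _ _))
  · have h := hmin j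
    simp only [← sq] at h
    exact (Real.sqrt_le_sqrt_iff (Finset.sum_nonneg fun _ _ => sq_nonneg _)).1 h

/-! ### Polynomial preprocessing time -/

variable {n d : ℕ}

theorem length_selected_le {T : ℕ} (ch : Fin T → Fin d → Bool) :
    (selected ch).length ≤ T * d := by
  have : ∀ l : List (Fin T), (l.flatMap fun t =>
      (List.finRange d).filter fun b => ch t b).length ≤ l.length * d := by
    intro l
    induction l with
    | nil => simp
    | cons t l ih =>
      rw [List.flatMap_cons, List.length_append, List.length_cons, Nat.succ_mul, add_comm]
      exact Nat.add_le_add ih ((List.length_filter_le _ _).trans_eq (List.length_finRange))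
  exact (this (List.finRange T)).trans_eq (by rw [List.length_finRange])

theorem spec_probabilities (x : Fin n × Fin d → ℝ) :
    Spec x (probabilities n d) (n * (n * (d * 4 + d)) + d * (n * (n * 6 + n) + n))
      fun _ => True := by
  refine Spec.bind (Q := fun _ => True) (Spec.tabulate fun i => Spec.tabulate fun j => ?_)
    fun D _ => Spec.tabulate fun b => ?_
  · refine Spec.bind (Q := fun _ => True) (Spec.tabulate fun b => ?_) fun w _ => Spec.total _ _
    exact (Spec.readInput _).bind (N' := 3) fun _ _ => (Spec.readInput _).bind (N' := 2)
      fun _ _ => (Spec.op _).bind fun _ _ => Spec.op _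
  · refine Spec.bind (Q := fun _ => True) (Spec.tabulate fun i => ?_)
      fun w _ => Spec.maximum _ _
    refine Spec.bind (Q := fun _ => True) (Spec.tabulate fun j => ?_)
      fun w _ => Spec.maximum _ _
    refine (Spec.isLE _ _).bind (N' := 5) fun h _ => ?_
    cases h
    · exact (Spec.readInput _).bind (N' := 4) fun _ _ => (Spec.readInput _).bind (N' := 3)
        fun _ _ => (Spec.op _).bind (N' := 2) fun _ _ => (Spec.op _).bind fun _ _ => Spec.op _
    · exact (Spec.pure trivial).mono (Nat.zero_le _) fun _ => id

/-- The time bound concerns every run, so the sample size enters through its trivial bound `T * d`.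
-/
theorem spec_preprocess (x : Fin n × Fin d → ℝ) (T m : ℕ) :
    Spec x (preprocess n d T m)
      (n * (n * (d * 4 + d)) + d * (n * (n * 6 + n) + n) + (T * d + (n * (T * d * 3) +
        (m * (T * d * 4) + n * (m * (T * d + T * d)))))) fun _ => True := by
  refine (spec_probabilities x).bind fun p _ => ?_
  refine Spec.bind (Q := fun I => I.length ≤ T * d) ?_ fun I hI => ?_
  · refine ((Spec.tabulate (N := d) fun _ => ?_).bind (N' := 0) fun ch _ =>
      Spec.pure (length_selected_le ch)).mono le_rfl fun _ => id
    exact (Spec.tabulate fun _ => Spec.flip _).mono (by simp) fun _ => id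
  refine Spec.bind (Q := fun _ => True) (Spec.tabulate fun i => ?_) fun r _ => ?_
  · refine (Spec.tabulate (N := 3) fun k => ?_).mono (Nat.mul_le_mul_right _ hI) fun _ => id
    exact (Spec.readInput _).bind (N' := 2) fun _ _ => (Spec.op _).bind fun _ _ => Spec.op _
  refine Spec.bind (Q := fun _ => True) (Spec.tabulate fun l => ?_) fun M _ => ?_
  · refine (Spec.tabulate (N := 4) fun k => ?_).mono (Nat.mul_le_mul_right _ hI) fun _ => id
    refine (Spec.flip _).bind (N' := 3) fun h _ => (Spec.op _).bind (N' := 2) fun _ _ =>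
      (Spec.op _).bind (N' := 1) fun _ _ => ?_
    cases h
    · exact Spec.op _
    · exact (Spec.pure trivial).mono (Nat.zero_le _) fun _ => id
  refine Spec.mono (N := n * (m * (T * d + T * d)) + 0) (Spec.bind (Q := fun _ => True)
    (Spec.tabulate fun i => ?_) fun _ _ => Spec.pure trivial) le_rfl fun _ => id
  exact (Spec.mulVec _ _).mono
    (Nat.mul_le_mul_left _ (Nat.add_le_add hI hI)) fun _ => id

/-- The term `n * m * T * d` has the largest degree, `1 + 6 + 8 + 1 = 16`. The terms without `T`
have coefficients adding up to `13`, those with `T` to `10`. -/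
theorem step_polynomial_le {S A B n d T m : ℝ} (hS : 1 ≤ S) (hA : 0 ≤ A) (hB : 0 ≤ B)
    (hn : 0 ≤ n) (hd : 0 ≤ d) (hT : 0 ≤ T) (hm : 0 ≤ m) (hnS : n ≤ S) (hdS : d ≤ S)
    (hTS : T ≤ (A + 1) * S ^ 8) (hmS : m ≤ (B + 1) * S ^ 6) :
    n * (n * (d * 4 + d)) + d * (n * (n * 6 + n) + n) + (T * d + (n * (T * d * 3) +
        (m * (T * d * 4) + n * (m * (T * d + T * d))))) ≤
      (13 + 10 * (A + 1) * (B + 1)) * S ^ 16 := by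
  have hS0 : 0 ≤ S := zero_le_one.trans hS
  have e2 : S ^ 2 ≤ S ^ 16 := pow_le_pow_right₀ hS (by norm_num)
  have e3 : S ^ 3 ≤ S ^ 16 := pow_le_pow_right₀ hS (by norm_num)
  have e9 : S ^ 9 ≤ S ^ 16 := pow_le_pow_right₀ hS (by norm_num)
  have e10 : S ^ 10 ≤ S ^ 16 := pow_le_pow_right₀ hS (by norm_num)
  have e15 : S ^ 15 ≤ S ^ 16 := pow_le_pow_right₀ hS (by norm_num)
  have hAB : A + 1 ≤ (A + 1) * (B + 1) :=
    le_mul_of_one_le_right (by linarith) (by linarith)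
  have hTd : T * d ≤ (A + 1) * S ^ 9 :=
    (mul_le_mul hTS hdS hd (by positivity)).trans_eq (by ring)
  have hnn : n * n ≤ S ^ 2 := (mul_le_mul hnS hnS hn hS0).trans_eq (by ring)
  have h1 : n * n * d ≤ S ^ 16 :=
    (mul_le_mul hnn hdS hd (by positivity)).trans (by rw [← pow_succ]; exact e3)
  have h2 : n * d ≤ S ^ 16 := (mul_le_mul hnS hdS hd hS0).trans (by rw [← sq]; exact e2)
  have h3 : T * d ≤ (A + 1) * (B + 1) * S ^ 16 := hTd.trans (by gcongr)
  have h4 : n * (T * d) ≤ (A + 1) * (B + 1) * S ^ 16 := by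
    calc _ ≤ S * ((A + 1) * S ^ 9) := by gcongr
      _ = (A + 1) * S ^ 10 := by ring
      _ ≤ _ := by gcongr
  have h5 : m * (T * d) ≤ (A + 1) * (B + 1) * S ^ 15 := by
    calc _ ≤ ((B + 1) * S ^ 6) * ((A + 1) * S ^ 9) := by gcongr
      _ = _ := by ring
  have h6 : n * (m * (T * d)) ≤ (A + 1) * (B + 1) * S ^ 16 := by
    calc _ ≤ S * ((A + 1) * (B + 1) * S ^ 15) := by gcongr
      _ = _ := by ring
  have h7 : m * (T * d) ≤ (A + 1) * (B + 1) * S ^ 16 := h5.trans (by gcongr)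
  linarith

theorem steps_le {n d T m : ℕ} {A B ε δ : ℝ} (hA : 0 ≤ A) (hB : 0 ≤ B) (hn : 1 ≤ n)
    (hε : 0 < ε) (hδ : 0 < δ) (hδ1 : δ < 1) (hT : T = rounds A n ε δ)
    (hm : m = targetDim B n ε δ) :
    ((n * (n * (d * 4 + d)) + d * (n * (n * 6 + n) + n) + (T * d + (n * (T * d * 3) +
        (m * (T * d * 4) + n * (m * (T * d + T * d))))) : ℕ) : ℝ) ≤
      (13 + 10 * (A + 1) * (B + 1)) * (n + d + 1 / ε + 1 / δ) ^ 16 := by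
  obtain ⟨S, hS⟩ : ∃ S : ℝ, S = n + d + 1 / ε + 1 / δ := ⟨_, rfl⟩
  rw [← hS]
  have hn1 : (1 : ℝ) ≤ n := by exact_mod_cast hn
  have hd0 : (0 : ℝ) ≤ d := d.cast_nonneg
  have he0 : 0 < 1 / ε := by positivity
  have hdl0 : 0 < 1 / δ := by positivity
  have hS1 : 1 ≤ S := by linarith
  have hnS : (n : ℝ) ≤ S := by linarith
  have hdS : (d : ℝ) ≤ S := by linarith
  have heS : 1 / ε ≤ S := by linarith
  have hdlS : 1 / δ ≤ S := by linarith
  have hlog : Real.log (n / δ) ≤ S ^ 2 := by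
    refine (Real.log_le_self (by positivity)).trans ?_
    rw [div_eq_mul_one_div, sq]
    gcongr
  have hlog0 : 0 ≤ Real.log (n / δ) :=
    Real.log_nonneg ((one_le_div hδ).2 (by linarith))
  have hTS : (T : ℝ) ≤ (A + 1) * S ^ 8 := by
    have h1 : A * Real.log (n / δ) / (ε ^ 4 * δ ^ 2) ≤ A * S ^ 8 := by
      have : A * Real.log (n / δ) / (ε ^ 4 * δ ^ 2) =
          A * (Real.log (n / δ) * ((1 / ε) ^ 4 * (1 / δ) ^ 2)) := by field_simp
      rw [this]
      calc _ ≤ A * (S ^ 2 * (S ^ 4 * S ^ 2)) := by gcongr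
        _ = A * S ^ 8 := by ring
    have h2 := (Nat.ceil_lt_add_one (a := A * Real.log (n / δ) / (ε ^ 4 * δ ^ 2))
      (by positivity)).le
    rw [hT, rounds]
    calc _ ≤ _ := h2
      _ ≤ A * S ^ 8 + S ^ 8 := add_le_add h1 (one_le_pow₀ hS1)
      _ = _ := by ring
  have hmS : (m : ℝ) ≤ (B + 1) * S ^ 6 := by
    have h1 : B * Real.log (n / δ) / (ε ^ 2 * δ ^ 2) ≤ B * S ^ 6 := by
      have : B * Real.log (n / δ) / (ε ^ 2 * δ ^ 2) =
          B * (Real.log (n / δ) * ((1 / ε) ^ 2 * (1 / δ) ^ 2)) := by field_simp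
      rw [this]
      calc _ ≤ B * (S ^ 2 * (S ^ 2 * S ^ 2)) := by gcongr
        _ = B * S ^ 6 := by ring
    have h2 := (Nat.ceil_lt_add_one (a := B * Real.log (n / δ) / (ε ^ 2 * δ ^ 2))
      (by positivity)).le
    rw [hm, targetDim]
    calc _ ≤ _ := h2
      _ ≤ B * S ^ 6 + S ^ 6 := add_le_add h1 (one_le_pow₀ hS1)
      _ = _ := by ring
  push_cast
  exact step_polynomial_le hS1 hA hB (by positivity) hd0 (by positivity) (by positivity)
    hnS hdS hTS hmS

/-! ### The sampling probabilities -/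

section Leverage

variable (c : Fin n → EuclideanSpace ℝ (Fin d))

theorem sqDist_eq (i j : Fin n) :
    sqDist (fun ib : Fin n × Fin d => c ib.1 ib.2) i j = ‖c i - c j‖ ^ 2 := by
  rw [EuclideanSpace.real_norm_sq_eq]
  simp [sqDist, sq]

theorem sampleProb_nonneg (x : Fin n × Fin d → ℝ) (b : Fin d) : 0 ≤ sampleProb x b :=
  maxZero_nonneg _ _

theorem sq_sub_le_sampleProb (b : Fin d) (i j : Fin n) :
    (c i b - c j b) ^ 2 ≤
      sampleProb (fun ib : Fin n × Fin d => c ib.1 ib.2) b * ‖c i - c j‖ ^ 2 := by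
  by_cases h : c i = c j
  · simp [h]
  have hpos : 0 < ‖c i - c j‖ ^ 2 := by
    have := sub_ne_zero.2 h
    positivity
  rw [← div_le_iff₀ hpos]
  refine le_trans ?_ (le_maxZero _ i)
  refine le_trans ?_ (le_maxZero _ j)
  rw [sqDist_eq, if_neg (not_le.2 hpos), sq]

/-- A uniform bound for the quotients bounds the sampling probability. -/
theorem sampleProb_le {b : Fin d} {M : ℝ} (hM : 0 ≤ M)
    (h : ∀ i j, (c i b - c j b) ^ 2 ≤ M * ‖c i - c j‖ ^ 2) :
    sampleProb (fun ib : Fin n × Fin d => c ib.1 ib.2) b ≤ M := by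
  refine maxZero_le hM fun i => maxZero_le hM fun j => ?_
  rw [sqDist_eq]
  split_ifs with h0
  · exact hM
  · rw [div_le_iff₀ (not_le.1 h0), ← sq]
    exact h i j

theorem sampleProb_le_one (b : Fin d) :
    sampleProb (fun ib : Fin n × Fin d => c ib.1 ib.2) b ≤ 1 := by
  refine sampleProb_le c zero_le_one fun i j => ?_
  rw [one_mul, EuclideanSpace.real_norm_sq_eq]
  exact Finset.single_le_sum (f := fun b => (c i - c j) b ^ 2) (fun _ _ => sq_nonneg _)
    (Finset.mem_univ b)

/-- All differences lie in the span `V` of the points. With an orthonormal basis `e` of `V`,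
Cauchy–Schwarz bounds the quotients at `b` by the leverage score `∑ k, (e k)_b²`, and the leverage
scores add up to `dim V ≤ n`. -/
theorem sum_sampleProb_le :
    ∑ b, sampleProb (fun ib : Fin n × Fin d => c ib.1 ib.2) b ≤ n := by
  let V : Submodule ℝ (EuclideanSpace ℝ (Fin d)) := Submodule.span ℝ (Set.range c)
  let e := stdOrthonormalBasis ℝ V
  have hdim : Module.finrank ℝ V ≤ n := by
    exact (finrank_range_le_card (R := ℝ) c).trans_eq (Fintype.card_fin n)
  have hV : ∀ v : V, ∀ b, (v : EuclideanSpace ℝ (Fin d)) b ^ 2 ≤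
      (∑ k, (e k : EuclideanSpace ℝ (Fin d)) b ^ 2) * ‖(v : EuclideanSpace ℝ (Fin d))‖ ^ 2 := by
    intro v b
    have h1 : (v : EuclideanSpace ℝ (Fin d)) b =
        ∑ k, (e k : EuclideanSpace ℝ (Fin d)) b * inner ℝ (e k) v := by
      conv_lhs => rw [← e.sum_repr' v]
      simp [mul_comm]
    have h2 : ‖(v : EuclideanSpace ℝ (Fin d))‖ ^ 2 = ∑ k, (inner ℝ (e k) v) ^ 2 := by
      have h := e.sum_sq_norm_inner_right v
      simp only [Real.norm_eq_abs, sq_abs] at h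
      exact h.symm
    rw [h1, h2]
    exact Finset.sum_mul_sq_le_sq_mul_sq _ _ _
  calc ∑ b, sampleProb (fun ib : Fin n × Fin d => c ib.1 ib.2) b
      ≤ ∑ b, ∑ k, (e k : EuclideanSpace ℝ (Fin d)) b ^ 2 := by
        refine Finset.sum_le_sum fun b _ => sampleProb_le c
          (Finset.sum_nonneg fun _ _ => sq_nonneg _) fun i j => ?_
        exact hV ⟨c i - c j, V.sub_mem (Submodule.subset_span ⟨i, rfl⟩)
          (Submodule.subset_span ⟨j, rfl⟩)⟩ b
    _ = ∑ k, ‖(e k : EuclideanSpace ℝ (Fin d))‖ ^ 2 := by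
        rw [Finset.sum_comm]
        simp only [EuclideanSpace.real_norm_sq_eq]
    _ = Module.finrank ℝ V := by
        have h : ∀ k, ‖(e k : EuclideanSpace ℝ (Fin d))‖ = 1 := e.norm_eq_one
        simp [h]
    _ ≤ n := by exact_mod_cast hdim

end Leverage

/-! ### Concentration of the coordinate sampling -/

section Sampling

variable {d T : ℕ} {p : Fin d → ℝ}

/-- The sum of `g` over the selected coordinates, with multiplicity. -/
def sampleSum (ch : Fin T → Fin d → Bool) (g : Fin d → ℝ) : ℝ :=
  ∑ t, ∑ b, if ch t b then g b else 0

theorem sampleSum_add (ch : Fin T → Fin d → Bool) (g h : Fin d → ℝ) :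
    sampleSum ch (fun b => g b + h b) = sampleSum ch g + sampleSum ch h := by
  simp only [sampleSum, ← Finset.sum_add_distrib]
  refine Finset.sum_congr rfl fun t _ => Finset.sum_congr rfl fun b _ => ?_
  split_ifs <;> simp

theorem sampleSum_const_mul (ch : Fin T → Fin d → Bool) (r : ℝ) (g : Fin d → ℝ) :
    sampleSum ch (fun b => r * g b) = r * sampleSum ch g := by
  simp only [sampleSum, Finset.mul_sum, mul_ite, mul_zero]

theorem sampleSum_nonneg (ch : Fin T → Fin d → Bool) {g : Fin d → ℝ} (h : ∀ b, 0 ≤ g b) :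
    0 ≤ sampleSum ch g := by
  refine Finset.sum_nonneg fun t _ => Finset.sum_nonneg fun b _ => ?_
  split_ifs
  exacts [h b, le_rfl]

theorem mean_sampleSum (h0 : ∀ b, 0 ≤ p b) (h1 : ∀ b, p b ≤ 1) (g : Fin d → ℝ) :
    mean (roundsLaw T p) (fun ch => sampleSum ch g) = T * ∑ b, p b * g b := by
  simp only [sampleSum, roundsLaw, mean_sum]
  have : ∀ t : Fin T, ∀ b, mean (indep T fun _ => indep d fun b => coinLaw (p b))
      (fun ch => if ch t b then g b else 0) = p b * g b := by
    intro t b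
    rw [mean_indep_single _ t fun v : Fin d → Bool => if v b then g b else 0,
      mean_indep_single _ b fun h : Bool => if h then g b else 0,
      mean_coinLaw (h0 b) (h1 b)]
    simp
  simp [this]

/-- Comparison with a Poisson variable: each coin contributes `1 + p (exp g - 1) ≤ exp (p (exp g -
1))`. -/
theorem mean_exp_sampleSum_le (h0 : ∀ b, 0 ≤ p b) (h1 : ∀ b, p b ≤ 1) (g : Fin d → ℝ) :
    mean (roundsLaw T p) (fun ch => Real.exp (sampleSum ch g)) ≤
      Real.exp (T * ∑ b, p b * (Real.exp (g b) - 1)) := by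
  have e : ∀ ch : Fin T → Fin d → Bool, Real.exp (sampleSum ch g) =
      ∏ t, ∏ b, Real.exp (if ch t b then g b else 0) := by
    intro ch
    simp only [sampleSum, Real.exp_sum]
  simp only [e, roundsLaw]
  rw [mean_indep_prod _ fun _ (v : Fin d → Bool) => ∏ b, Real.exp (if v b then g b else 0)]
  simp only [mean_indep_prod _ fun b (h : Bool) => Real.exp (if h then g b else 0)]
  rw [Finset.prod_const, Finset.card_univ, Fintype.card_fin, Real.exp_nat_mul, Real.exp_sum]
  refine pow_le_pow_left₀ (Finset.prod_nonneg fun b _ => mean_nonneg _ fun _ =>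
    (Real.exp_pos _).le) (Finset.prod_le_prod (fun b _ => mean_nonneg _ fun _ =>
    (Real.exp_pos _).le) fun b _ => ?_) _
  rw [mean_coinLaw (h0 b) (h1 b)]
  have := Real.add_one_le_exp (p b * (Real.exp (g b) - 1))
  simp only [if_true, Bool.false_eq_true, if_false, Real.exp_zero]
  linarith

/-- Chernoff with parameter `1`: the exponent `(e - 1)TN ≤ 2TN` is beaten by the threshold `3TN`. -/
theorem size_tail (h0 : ∀ b, 0 ≤ p b) (h1 : ∀ b, p b ≤ 1) {N : ℝ} (hN : ∑ b, p b ≤ N) :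
    (roundsLaw T p).toOuterMeasure {ch | 3 * T * N < sampleSum ch fun _ => 1} ≤
      ENNReal.ofReal (Real.exp (-(T * N))) := by
  refine (toOuterMeasure_le_mean _
    (f := fun ch => Real.exp (-(3 * T * N)) * Real.exp (sampleSum ch fun _ => 1))
    (fun _ => by positivity) fun ch hch => ?_).trans (ENNReal.ofReal_le_ofReal ?_)
  · rw [← Real.exp_add]
    refine Real.one_le_exp ?_
    have : 3 * T * N < sampleSum ch fun _ => 1 := hch
    linarith
  · rw [mean_const_mul]
    refine (mul_le_mul_of_nonneg_left (mean_exp_sampleSum_le h0 h1 _)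
      (Real.exp_pos _).le).trans ?_
    rw [← Real.exp_add, ← Finset.sum_mul]
    refine Real.exp_le_exp.2 ?_
    have he : Real.exp 1 - 1 ≤ 2 := by linarith [Real.exp_one_lt_d9]
    have he0 : 0 ≤ Real.exp 1 - 1 := by linarith [Real.add_one_le_exp (1 : ℝ)]
    have hp : 0 ≤ ∑ b, p b := Finset.sum_nonneg fun b _ => h0 b
    have : (T : ℝ) * ((∑ b, p b) * (Real.exp 1 - 1)) ≤ T * (N * 2) := by gcongr; linarith
    linarith

theorem sampled_norm_tail (h0 : ∀ b, 0 ≤ p b) (h1 : ∀ b, p b ≤ 1) (a : Fin d → ℝ) {δ : ℝ}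
    (hδ : 0 < δ) (hT : 0 < T) :
    (roundsLaw T p).toOuterMeasure
      {ch | 8 / δ * (T * ∑ b, a b ^ 2) < sampleSum ch fun b => a b ^ 2 / p b} ≤
      ENNReal.ofReal (δ / 8) := by
  rcases (Finset.sum_nonneg fun b (_ : b ∈ Finset.univ) => sq_nonneg (a b)).eq_or_lt with h | h
  · have ha : ∀ b, a b ^ 2 = 0 := fun b =>
      (Finset.sum_eq_zero_iff_of_nonneg fun b _ => sq_nonneg (a b)).1 h.symm b
        (Finset.mem_univ b)
    simp [ha, sampleSum]
  have hT' : (0 : ℝ) < T := by exact_mod_cast hT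
  refine (toOuterMeasure_le_mean _
    (f := fun ch => δ / (8 * (T * ∑ b, a b ^ 2)) * sampleSum ch fun b => a b ^ 2 / p b)
    (fun ch => mul_nonneg (by positivity) (sampleSum_nonneg ch fun b =>
      div_nonneg (sq_nonneg _) (h0 b))) fun ch hch => ?_).trans
    (ENNReal.ofReal_le_ofReal ?_)
  · have hch : 8 / δ * (T * ∑ b, a b ^ 2) < sampleSum ch fun b => a b ^ 2 / p b := hch
    refine le_trans (le_of_eq ?_) (mul_le_mul_of_nonneg_left hch.le (by positivity))
    field_simp
  · rw [mean_const_mul, mean_sampleSum h0 h1]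
    -- Only an inequality: coordinates with `p b = 0` are never sampled, but `a b` need not vanish
    -- there.
    have : ∑ b, p b * (a b ^ 2 / p b) ≤ ∑ b, a b ^ 2 := by
      refine Finset.sum_le_sum fun b _ => ?_
      rcases eq_or_ne (p b) 0 with hb | hb
      · simp [hb, sq_nonneg]
      · rw [mul_div_cancel₀ _ hb]
    calc _ ≤ δ / (8 * (T * ∑ b, a b ^ 2)) * (T * ∑ b, a b ^ 2) := by gcongr
      _ = δ / 8 := by field_simp

/-- The second-order bound for `exp y` fails for large `y`; it is rescued by a penalty `r` that
dominates `y` there. For `y < -1` the right side already exceeds `1`. -/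
theorem exp_sub_le {y r : ℝ} (hr : 0 ≤ r) (h : 1 < y → y ≤ r) :
    Real.exp (y - r) ≤ 1 + y + y ^ 2 := by
  rcases le_or_gt |y| 1 with h1 | h1
  · have h2 := (abs_le.1 (Real.abs_exp_sub_one_sub_id_le h1)).2
    have h3 : Real.exp (y - r) ≤ Real.exp y := Real.exp_le_exp.2 (by linarith)
    linarith
  · rcases lt_abs.1 h1 with h2 | h2
    · have : Real.exp (y - r) ≤ 1 := Real.exp_le_one_iff.2 (by linarith [h h2])
      nlinarith
    · have : Real.exp (y - r) ≤ 1 := Real.exp_le_one_iff.2 (by linarith)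
      nlinarith

/-- One coordinate's contribution to the log-moment in `gap_tail`. The term `κ a²` serves as the
penalty of `exp_sub_le`, so no bound of `a` in terms of `p` is needed; it then disappears from the
right side. -/
theorem coordinate_bound {p a v V κ l : ℝ} (hp : 0 ≤ p) (hv : v ^ 2 ≤ p * V)
    (hl : 0 ≤ l) (hlκ : 4 * (l * V) ≤ κ) (hV : 0 ≤ V) :
    p * (Real.exp (-l * ((2 * a * v + v ^ 2 + κ * a ^ 2) / p)) - 1) ≤
      -l * (2 * a * v + v ^ 2) + l ^ 2 * V * (8 * a ^ 2 + 2 * v ^ 2) := by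
  rcases hp.eq_or_lt with rfl | hp
  · have hv0 : v = 0 := by
      rw [zero_mul] at hv
      exact pow_eq_zero_iff two_ne_zero |>.1 (le_antisymm hv (sq_nonneg v))
    subst hv0
    simp only [zero_mul, mul_zero, ne_eq, OfNat.ofNat_ne_zero, not_false_eq_true, zero_pow,
      add_zero, zero_add]
    positivity
  have hκ : 0 ≤ κ := le_trans (by positivity) hlκ
  set y : ℝ := -l * (2 * a * v + v ^ 2) / p with hy
  have h1 : Real.exp (-l * ((2 * a * v + v ^ 2 + κ * a ^ 2) / p)) ≤ 1 + y + y ^ 2 := by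
    have : -l * ((2 * a * v + v ^ 2 + κ * a ^ 2) / p) = y - l * κ * a ^ 2 / p := by
      rw [hy]; ring
    rw [this]
    -- For `y > 1`, dropping `v²` gives `y ≤ z`, hence `y ≤ y² ≤ z²`; and `v² ≤ p V` with `4lV ≤ κ`
    -- makes `z²` at most the penalty.
    refine exp_sub_le (by positivity) fun hy1 => ?_
    have hz : y ≤ -(2 * l * (a * v)) / p := by
      rw [hy]
      gcongr
      nlinarith [mul_nonneg hl (sq_nonneg v)]
    set z : ℝ := -(2 * l * (a * v)) / p with hzdef
    have hz2 : z ^ 2 ≤ l * κ * a ^ 2 / p := by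
      have : z ^ 2 = 4 * l ^ 2 * a ^ 2 * v ^ 2 / p / p := by rw [hzdef]; field_simp; ring
      rw [this]
      gcongr
      rw [div_le_iff₀ hp]
      calc 4 * l ^ 2 * a ^ 2 * v ^ 2 ≤ 4 * l ^ 2 * a ^ 2 * (p * V) := by gcongr
        _ = (4 * (l * V)) * (l * a ^ 2 * p) := by ring
        _ ≤ κ * (l * a ^ 2 * p) := by gcongr
        _ = _ := by ring
    nlinarith
  have h2 : p * y ^ 2 ≤ l ^ 2 * V * (8 * a ^ 2 + 2 * v ^ 2) := by
    have : p * y ^ 2 = l ^ 2 * ((2 * a * v + v ^ 2) ^ 2) / p := by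
      rw [hy]; field_simp
    rw [this, div_le_iff₀ hp]
    have h3 : (2 * a * v + v ^ 2) ^ 2 ≤ (8 * a ^ 2 + 2 * v ^ 2) * v ^ 2 := by
      nlinarith [sq_nonneg (2 * a * v - v ^ 2)]
    calc l ^ 2 * ((2 * a * v + v ^ 2) ^ 2)
        ≤ l ^ 2 * ((8 * a ^ 2 + 2 * v ^ 2) * v ^ 2) := by gcongr
      _ ≤ l ^ 2 * ((8 * a ^ 2 + 2 * v ^ 2) * (p * V)) := by gcongr
      _ = _ := by ring
  have h4 : p * y = -l * (2 * a * v + v ^ 2) := by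
    rw [hy]; field_simp
  calc _ ≤ p * (1 + y + y ^ 2 - 1) := by gcongr
    _ = p * y + p * y ^ 2 := by ring
    _ ≤ _ := by linarith

theorem gap_tail (h0 : ∀ b, 0 ≤ p b) (h1 : ∀ b, p b ≤ 1) (a v : Fin d → ℝ) {ε δ V Δ : ℝ}
    (hε : 0 < ε) (hδ : 0 < δ) (hδ1 : δ < 1) (hV : ∑ b, v b ^ 2 = V) (hV0 : 0 < V)
    (hv : ∀ b, v b ^ 2 ≤ p b * V) (hΔ : ∑ b, (2 * a b * v b + v b ^ 2) = Δ)
    (haΔ : 2 * (ε * ∑ b, a b ^ 2) ≤ Δ) (hVΔ : ε * V ≤ 3 * Δ) :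
    (roundsLaw T p).toOuterMeasure
      {ch | (sampleSum ch fun b =>
        (2 * a b * v b + v b ^ 2 + ε * δ / 16 * a b ^ 2) / p b) ≤ 3 / 4 * (T * Δ)} ≤
      ENNReal.ofReal (Real.exp (-(T * (ε ^ 2 * δ / 1920)))) := by
  -- Now `4lV = εδ/20` is below `κ = εδ/16`, and the quadratic terms sum to at most `lΔ/8`. Against
  -- the threshold `3/4` an exponent of `-TlΔ/8` remains, and `Δ ≥ εV/3` yields `1920 = 80 * 3 * 8`.
  set l : ℝ := ε * δ / 80 / V with hl
  have hl0 : 0 < l := by positivity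
  have hlV : l * V = ε * δ / 80 := by rw [hl]; field_simp
  refine (toOuterMeasure_le_mean _
    (f := fun ch => Real.exp (l * (3 / 4 * (T * Δ))) * Real.exp (sampleSum ch fun b =>
        -l * ((2 * a b * v b + v b ^ 2 + ε * δ / 16 * a b ^ 2) / p b)))
    (fun _ => by positivity) fun ch hch => ?_).trans (ENNReal.ofReal_le_ofReal ?_)
  · rw [← Real.exp_add, sampleSum_const_mul]
    refine Real.one_le_exp ?_
    have := mul_le_mul_of_nonneg_left (Set.mem_ofPred.1 hch) hl0.le
    linarith
  · rw [mean_const_mul]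
    refine (mul_le_mul_of_nonneg_left (mean_exp_sampleSum_le h0 h1 _)
      (Real.exp_pos _).le).trans ?_
    rw [← Real.exp_add]
    refine Real.exp_le_exp.2 ?_
    have hsum : ∑ b, p b * (Real.exp (-l *
        ((2 * a b * v b + v b ^ 2 + ε * δ / 16 * a b ^ 2) / p b)) - 1) ≤
        -l * Δ + l * (l * V) * (8 * (∑ b, a b ^ 2) + 2 * V) := by
      refine (Finset.sum_le_sum fun b _ => coordinate_bound (a := a b) (h0 b) (hv b) hl0.le
        (κ := ε * δ / 16) (by rw [hlV]; nlinarith [mul_pos hε hδ]) hV0.le).trans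
        (le_of_eq ?_)
      rw [Finset.sum_add_distrib, ← Finset.mul_sum, ← Finset.mul_sum, hΔ,
        Finset.sum_add_distrib, ← Finset.mul_sum, ← Finset.mul_sum, hV]
      ring
    rw [hlV] at hsum
    have hΔ0 : 0 ≤ Δ := by nlinarith [mul_pos hε hV0]
    have h2 : ε * δ / 80 * (8 * (∑ b, a b ^ 2) + 2 * V) ≤ Δ / 8 := by
      calc _ = δ / 80 * (4 * (2 * (ε * ∑ b, a b ^ 2)) + 2 * (ε * V)) := by ring
        _ ≤ δ / 80 * (4 * Δ + 2 * (3 * Δ)) := by gcongr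
        _ = δ * (Δ / 8) := by ring
        _ ≤ 1 * (Δ / 8) := by gcongr
        _ = _ := one_mul _
    have h3 : l * Δ / 8 ≥ ε ^ 2 * δ / 1920 := by
      have : ε ^ 2 * δ / 1920 = l * (ε * V / 3) / 8 := by rw [hl]; field_simp; ring
      rw [this]
      have : ε * V / 3 ≤ Δ := by linarith
      gcongr
    have h4 : -l * Δ + l * (ε * δ / 80) * (8 * (∑ b, a b ^ 2) + 2 * V) ≤
        -l * Δ + l * (Δ / 8) := by
      rw [mul_assoc]
      gcongr
    have h5 := mul_le_mul_of_nonneg_left (hsum.trans h4) (Nat.cast_nonneg (α := ℝ) T)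
    have h6 := mul_le_mul_of_nonneg_left h3 (Nat.cast_nonneg (α := ℝ) T)
    linarith

/-- A gap between two squared distances survives the sampling. -/
theorem gap_sampled (h0 : ∀ b, 0 ≤ p b) {a v : Fin d → ℝ} {ε δ Δ : ℝ}
    (hε : 0 < ε) (hδ : 0 < δ) (hT : 0 < T) (hΔ0 : 0 < Δ)
    (haΔ : 2 * (ε * ∑ b, a b ^ 2) ≤ Δ) {ch : Fin T → Fin d → Bool}
    (hN : (sampleSum ch fun b => a b ^ 2 / p b) ≤ 8 / δ * (T * ∑ b, a b ^ 2))
    (hZ : 3 / 4 * (T * Δ) < sampleSum ch fun b =>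
        (2 * a b * v b + v b ^ 2 + ε * δ / 16 * a b ^ 2) / p b) :
    0 < (sampleSum ch fun b => (a b + v b) ^ 2 / p b) ∧
      (1 + ε * δ / 8) * (sampleSum ch fun b => a b ^ 2 / p b) ≤
        sampleSum ch fun b => (a b + v b) ^ 2 / p b := by
  have hT' : (0 : ℝ) < T := by exact_mod_cast hT
  have e : (sampleSum ch fun b =>
      (2 * a b * v b + v b ^ 2 + ε * δ / 16 * a b ^ 2) / p b) =
      (sampleSum ch fun b => (a b + v b) ^ 2 / p b) +
        (ε * δ / 16 - 1) * sampleSum ch fun b => a b ^ 2 / p b := by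
    rw [← sampleSum_const_mul, ← sampleSum_add]
    congr 1; funext b; ring
  rw [e] at hZ
  set P := sampleSum ch fun b => a b ^ 2 / p b
  have hP : 0 ≤ P := sampleSum_nonneg ch fun b => div_nonneg (sq_nonneg _) (h0 b)
  -- Hence `εδ/16 * P ≤ TΔ/4`: the sampled gap is still more than `TΔ/2`, which is at least `εδ/8 *
  -- P`.
  have h2 : ε * δ * P ≤ 8 * ε * (T * ∑ b, a b ^ 2) := by
    calc _ ≤ ε * δ * (8 / δ * (T * ∑ b, a b ^ 2)) := by gcongr
      _ = _ := by field_simp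
  have h3 := mul_le_mul_of_nonneg_left haΔ hT'.le
  have h4 : 0 < T * Δ := by positivity
  constructor <;> linarith

end Sampling

/-! ### Random sign projections -/

section Signs

/-- The sum of the entries of `x` with the signs given by the coins `v`. -/
def signSum {k : ℕ} (v : Fin k → Bool) (x : Fin k → ℝ) : ℝ :=
  ∑ j, if v j then x j else -x j

/-- Averaging over one sign turns the cross term into `cosh (2γcs) ≤ exp (2γ²c²s²)`, which only
raises the coefficient of `c²`. -/
theorem average_exp_sq_le (γ L c s : ℝ) (hγ : |γ| ≤ 2 * L) :
    1 / 2 * Real.exp (γ * (c + s) ^ 2) + (1 - 1 / 2) * Real.exp (γ * (c + -s) ^ 2) ≤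
      Real.exp ((γ + 8 * L ^ 2 * s ^ 2) * c ^ 2 + γ * s ^ 2) := by
  have h1 : 1 / 2 * Real.exp (γ * (c + s) ^ 2) + (1 - 1 / 2) * Real.exp (γ * (c + -s) ^ 2) =
      Real.exp (γ * (c ^ 2 + s ^ 2)) * Real.cosh (2 * γ * c * s) := by
    have e1 : γ * (c + s) ^ 2 = γ * (c ^ 2 + s ^ 2) + 2 * γ * c * s := by ring
    have e2 : γ * (c + -s) ^ 2 = γ * (c ^ 2 + s ^ 2) + -(2 * γ * c * s) := by ring
    rw [e1, e2, Real.exp_add, Real.exp_add, Real.cosh_eq]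
    ring
  rw [h1]
  refine (mul_le_mul_of_nonneg_left (Real.cosh_le_exp_half_sq _) (Real.exp_pos _).le).trans ?_
  rw [← Real.exp_add]
  refine Real.exp_le_exp.2 ?_
  have h2 : γ ^ 2 ≤ (2 * L) ^ 2 := sq_le_sq.2 (hγ.trans (le_abs_self _))
  have h3 := mul_le_mul_of_nonneg_right h2 (by positivity : 0 ≤ 2 * (c ^ 2 * s ^ 2))
  linarith

/-- The signs are averaged out one at a time, which is why the shift `c` is needed. Each step raises
the coefficient by `8L²x_j²`, and the hypothesis keeps it within `2L` throughout. Either sign of `α`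
is allowed, so both tails follow. -/
theorem mean_exp_shifted_sq_le {k : ℕ} (x : Fin k → ℝ) (L α c : ℝ)
    (h : |α| + 8 * L ^ 2 * (∑ j, x j ^ 2) ≤ 2 * L) :
    mean (indep k fun _ => coinLaw (1 / 2))
        (fun v => Real.exp (α * (c + signSum v x) ^ 2)) ≤
      Real.exp ((α + 8 * L ^ 2 * ∑ j, x j ^ 2) * (c ^ 2 + ∑ j, x j ^ 2)) := by
  induction k generalizing c with
  | zero =>
    simp [signSum, mean, indep_apply]
  | succ k ih =>
    rw [mean_indep_succ]
    rw [Fin.sum_univ_succ] at h ⊢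
    set S := ∑ j : Fin k, x j.succ ^ 2
    have hS : 0 ≤ S := Finset.sum_nonneg fun _ _ => sq_nonneg _
    have hx : 0 ≤ 8 * L ^ 2 * x 0 ^ 2 := by positivity
    have hL : 0 ≤ 8 * L ^ 2 * S := by positivity
    have hstep : ∀ b : Bool, mean (indep k fun _ => coinLaw (1 / 2)) (fun v =>
        Real.exp (α * (c + signSum (Fin.cons b v : Fin (k + 1) → Bool) x) ^ 2)) ≤
        Real.exp ((α + 8 * L ^ 2 * S) * ((c + if b then x 0 else -x 0) ^ 2 + S)) := by
      intro b
      have := ih (fun j => x j.succ) (c + if b then x 0 else -x 0) (by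
        linarith)
      simpa [signSum, Fin.sum_univ_succ, add_assoc] using this
    refine (mean_mono _ hstep).trans ?_
    rw [mean_coinLaw (by norm_num) (by norm_num)]
    simp only [if_true, Bool.false_eq_true, if_false, mul_add _ _ S, Real.exp_add]
    rw [← mul_assoc, ← mul_assoc, ← add_mul]
    have hγ : |α + 8 * L ^ 2 * S| ≤ 2 * L := by
      refine (abs_add_le _ _).trans ?_
      rw [abs_of_nonneg hL]
      linarith
    refine (mul_le_mul_of_nonneg_right (average_exp_sq_le _ L c (x 0) hγ)
      (Real.exp_pos _).le).trans ?_
    rw [← Real.exp_add]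
    refine Real.exp_le_exp.2 ?_
    have : 0 ≤ 8 * L ^ 2 * x 0 ^ 2 * (x 0 ^ 2 + S) := by positivity
    linarith

/-- Both tails of the squared norm of a random sign projection, distinguished by `σ = ±1`. -/
theorem sign_tail {m k : ℕ} (x : Fin k → ℝ) {σ θ : ℝ} (hσ : |σ| = 1) (hθ : 0 < θ)
    (hθ1 : θ ≤ 1) (hx : 0 < ∑ j, x j ^ 2) :
    (signsLaw m k).toOuterMeasure
      {s | (σ + θ) * (m * ∑ j, x j ^ 2) ≤ σ * ∑ l, signSum (s l) x ^ 2} ≤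
      ENNReal.ofReal (Real.exp (-(m * θ ^ 2 / 32))) := by
  set S := ∑ j, x j ^ 2
  -- With `u = r * S` the exponent is `m(-θu + 8u²)`, minimal at `u = θ/16`.
  set r : ℝ := θ / 16 / S with hr
  have hr0 : 0 < r := by positivity
  have hrS : r * S = θ / 16 := by rw [hr]; field_simp
  refine (toOuterMeasure_le_mean _
    (f := fun s => Real.exp (-(r * ((σ + θ) * (m * S)))) *
      ∏ l, Real.exp (r * σ * (0 + signSum (s l) x) ^ 2))
    (fun _ => by positivity) fun s hs => ?_).trans (ENNReal.ofReal_le_ofReal ?_)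
  · rw [← Real.exp_sum, ← Finset.mul_sum, ← Real.exp_add]
    refine Real.one_le_exp ?_
    have := mul_le_mul_of_nonneg_left (Set.mem_ofPred.1 hs) hr0.le
    simp only [zero_add]
    linarith
  · rw [mean_const_mul, signsLaw, mean_indep_prod _ fun _ (v : Fin k → Bool) =>
      Real.exp (r * σ * (0 + signSum v x) ^ 2), Finset.prod_const, Finset.card_univ,
      Fintype.card_fin]
    have h1 := mean_exp_shifted_sq_le x r (r * σ) 0 (by
      rw [abs_mul, hσ, abs_of_pos hr0]
      have : 8 * r ^ 2 * S = r * (θ / 2) := by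
        calc _ = 8 * r * (r * S) := by ring
          _ = _ := by rw [hrS]; ring
      rw [this]
      nlinarith)
    refine (mul_le_mul_of_nonneg_left (pow_le_pow_left₀ (mean_nonneg _ fun _ =>
      (Real.exp_pos _).le) h1 m) (Real.exp_pos _).le).trans ?_
    rw [← Real.exp_nat_mul, ← Real.exp_add]
    refine Real.exp_le_exp.2 (le_of_eq ?_)
    have e : -(r * ((σ + θ) * (m * S))) + m * ((r * σ + 8 * r ^ 2 * S) * (0 ^ 2 + S)) =
      -(m * θ * (r * S)) + 8 * m * (r * S) ^ 2 := by ring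
    rw [e, hrS]
    ring

/-- Random sign projections preserve the order of sufficiently different norms. -/
theorem sign_compare {m n k : ℕ} (x : Fin k → ℝ) (z : Fin n → Fin k → ℝ) {θ : ℝ}
    (hθ : 0 < θ) (hθ1 : θ ≤ 1 / 2) {far : Set (Fin n)}
    (hz : ∀ i ∈ far, 0 < ∑ j, z i j ^ 2)
    (hxz : ∀ i ∈ far, (1 + 4 * θ) * ∑ j, x j ^ 2 ≤ ∑ j, z i j ^ 2) :
    (signsLaw m k).toOuterMeasure
      {s | ∃ i ∈ far, ∑ l, signSum (s l) (z i) ^ 2 ≤ ∑ l, signSum (s l) x ^ 2} ≤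
      ENNReal.ofReal ((n + 1) * Real.exp (-(m * θ ^ 2 / 32))) := by
  classical
  set β := Real.exp (-(m * θ ^ 2 / 32))
  let U : Set (Fin m → Fin k → Bool) := {s | 0 < ∑ j, x j ^ 2 ∧
    (1 + θ) * (m * ∑ j, x j ^ 2) ≤ 1 * ∑ l, signSum (s l) x ^ 2}
  let W : Fin n → Set (Fin m → Fin k → Bool) := fun i => {s | i ∈ far ∧
    (-1 + θ) * (m * ∑ j, z i j ^ 2) ≤ -1 * ∑ l, signSum (s l) (z i) ^ 2}
  have hU : (signsLaw m k).toOuterMeasure U ≤ ENNReal.ofReal β := by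
    by_cases h : 0 < ∑ j, x j ^ 2
    · exact ((signsLaw m k).toOuterMeasure.mono fun s hs => hs.2).trans
        (sign_tail x (σ := 1) (by simp) hθ (by linarith) h)
    · simp [U, h]
  have hW : ∀ i, (signsLaw m k).toOuterMeasure (W i) ≤ ENNReal.ofReal β := by
    intro i
    by_cases h : i ∈ far
    · exact ((signsLaw m k).toOuterMeasure.mono fun s hs => hs.2).trans
        (sign_tail (z i) (σ := -1) (by simp) hθ (by linarith) (hz i h))
    · simp [W, h]
  have hsub : {s : Fin m → Fin k → Bool | ∃ i ∈ far,
      ∑ l, signSum (s l) (z i) ^ 2 ≤ ∑ l, signSum (s l) x ^ 2} ⊆ U ∪ ⋃ i, W i := by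
    rintro s ⟨i, hi, hle⟩
    by_contra hs
    simp only [Set.mem_union, Set.mem_iUnion, not_or, not_exists] at hs
    have h2 : ¬ (-1 + θ) * (m * ∑ j, z i j ^ 2) ≤ -1 * ∑ l, signSum (s l) (z i) ^ 2 :=
      fun h => hs.2 i ⟨hi, h⟩
    have hm : (0 : ℝ) ≤ m := m.cast_nonneg
    -- If `x = 0` the upper tail bound is not available, but then its projection vanishes while that
    -- of `z i` does not.
    rcases (Finset.sum_nonneg fun j (_ : j ∈ Finset.univ) => sq_nonneg (x j)).eq_or_lt
      with h | h
    · have hx0 : ∀ j, x j = 0 := fun j => pow_eq_zero_iff two_ne_zero |>.1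
        ((Finset.sum_eq_zero_iff_of_nonneg fun b _ => sq_nonneg (x b)).1 h.symm j
          (Finset.mem_univ j))
      have : ∑ l, signSum (s l) x ^ 2 = 0 := by simp [signSum, hx0]
      have hmz : 0 ≤ m * ∑ j, z i j ^ 2 := mul_nonneg hm (hz i hi).le
      nlinarith
    · have h1 : ¬ (1 + θ) * (m * ∑ j, x j ^ 2) ≤ 1 * ∑ l, signSum (s l) x ^ 2 :=
        fun h' => hs.1 ⟨h, h'⟩
      have h3 := mul_le_mul_of_nonneg_left (hxz i hi) hm
      have h4 := mul_le_mul_of_nonneg_left h3 (by linarith : 0 ≤ 1 - θ)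
      -- This is `(1 - θ)(1 + 4θ) ≥ 1 + θ`, true for `θ ≤ 1/2`.
      have h5 : 0 ≤ θ * (1 - 2 * θ) * (m * ∑ j, x j ^ 2) := by
        have : 0 ≤ 1 - 2 * θ := by linarith
        positivity
      linarith
  refine ((signsLaw m k).toOuterMeasure.mono hsub).trans ?_
  refine (MeasureTheory.measure_union_le (μ := (signsLaw m k).toOuterMeasure) U (⋃ i, W i)).trans ?_
  have hβ : 0 ≤ β := (Real.exp_pos _).le
  calc _ ≤ ENNReal.ofReal β + ∑ i, (signsLaw m k).toOuterMeasure (W i) :=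
        add_le_add hU (MeasureTheory.measure_iUnion_fintype_le _ _)
    _ ≤ ENNReal.ofReal β + ∑ _i : Fin n, ENNReal.ofReal β := by gcongr; exact hW _
    _ = ENNReal.ofReal ((n + 1) * β) := by
        rw [Finset.sum_const, Finset.card_univ, Fintype.card_fin, nsmul_eq_mul,
          ← ENNReal.ofReal_natCast, ← ENNReal.ofReal_mul (by positivity),
          ← ENNReal.ofReal_add hβ (by positivity)]
        congr 1
        ring

end Signs

/-! ### Success probability of one query -/

theorem estimate_buildData {n d T m : ℕ} (x : Fin n × Fin d → ℝ) (ch : Fin T → Fin d → Bool)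
    (s : Fin m → Fin (selected ch).length → Bool) (q : Fin d → ℝ) (i : Fin n) :
    estimate (buildData x ch s) q i = 1 / m * ∑ l, signSum (s l) (fun j =>
      (x (i, (selected ch).get j) - q ((selected ch).get j)) /
        Real.sqrt (sampleProb x ((selected ch).get j))) ^ 2 := by
  rw [Finset.mul_sum]
  refine Finset.sum_congr rfl fun l _ => ?_
  have hm : (1 / m : ℝ) = Real.sqrt (1 / m) ^ 2 := (Real.sq_sqrt (by positivity)).symm
  conv_rhs => rw [hm, ← mul_pow]
  refine congrArg (· ^ 2) ?_
  simp only [buildData, signSum, Finset.mul_sum]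
  refine (Finset.sum_sub_distrib (ι := Fin (selected ch).length) _ _).symm.trans ?_
  refine Finset.sum_congr rfl fun j _ => ?_
  simp only [toSignMatrix]
  split_ifs <;> ring

theorem sum_sq_div_sqrt {d T : ℕ} {p : Fin d → ℝ} (hp : ∀ b, 0 ≤ p b)
    (ch : Fin T → Fin d → Bool) (f : Fin d → ℝ) :
    ∑ j, (f ((selected ch).get j) / Real.sqrt (p ((selected ch).get j))) ^ 2 =
      sampleSum ch fun b => f b ^ 2 / p b := by
  rw [sampleSum, ← sum_selected]
  exact Finset.sum_congr rfl fun j _ => by rw [div_pow, Real.sq_sqrt (hp _)]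

section Combination

variable {n d : ℕ}

/-- The law of the data structure together with the outcome of the query to it. -/
def answerLaw {m : ℕ} [NeZero n] (D : DataStructure n d m) (q : Fin d → ℝ) :
    PMF (DataStructure n d m × Outcome (Fin n)) :=
  ((query D).run q).map fun r => (D, r)

theorem experiment_eq [NeZero n] (T m : ℕ) (c : Fin n → EuclideanSpace ℝ (Fin d))
    (q : EuclideanSpace ℝ (Fin d)) :
    experiment T m c q =
      (roundsLaw T (sampleProb fun ib : Fin n × Fin d => c ib.1 ib.2)).bind fun ch =>
        (signsLaw m (selected ch).length).bind fun s =>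
          answerLaw (buildData (fun ib : Fin n × Fin d => c ib.1 ib.2) ch s) fun b => q b := by
  have h : experiment T m c q = (val (fun ib : Fin n × Fin d => c ib.1 ib.2)
      (preprocess n d T m)).bind fun D => answerLaw D fun b => q b := by
    rw [val, PMF.bind_map]
    rfl
  rw [h, val_preprocess, PMF.bind_bind]
  congr 1; funext ch
  rw [PMF.bind_map]
  rfl

theorem answerLaw_compl {m : ℕ} [NeZero n] (D : DataStructure n d m) (q : Fin d → ℝ)
    {S : Set (DataStructure n d m × Outcome (Fin n))}
    (h : ∀ i t, (∀ j, estimate D q i ≤ estimate D q j) → (D, ⟨i, t, D.size⟩) ∈ S) :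
    (answerLaw D q).toOuterMeasure Sᶜ ≤ 0 := by
  obtain ⟨i, ⟨t, hrun⟩, hmin⟩ := run_query D q
  rw [answerLaw, hrun, PMF.pure_map, PMF.toOuterMeasure_pure_apply,
    if_neg fun hc => hc (h i t hmin)]

theorem length_selected {T : ℕ} (ch : Fin T → Fin d → Bool) :
    ((selected ch).length : ℝ) = sampleSum ch fun _ => 1 := by
  rw [sampleSum, ← sum_selected ch fun _ => 1]
  simp

/-- A single point has no differences, so all probabilities are `0` and almost surely nothing is
sampled. The case is separate because `log (1/δ)` can be arbitrarily small, leaving no room for even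
one probe. -/
theorem experiment_single [NeZero n] (hn : n = 1) (T m : ℕ)
    (c : Fin n → EuclideanSpace ℝ (Fin d)) (q : EuclideanSpace ℝ (Fin d))
    {S : Set (DataStructure n d m × Outcome (Fin n))}
    (h : ∀ ω, ω.2.probes = 0 → ω ∈ S) :
    (experiment T m c q).toOuterMeasure Sᶜ ≤ 0 := by
  subst hn
  have hp : ∀ b, sampleProb (fun ib : Fin 1 × Fin d => c ib.1 ib.2) b = 0 := fun b =>
    le_antisymm (sampleProb_le c le_rfl fun i j => by simp [Subsingleton.elim i j])
      (sampleProb_nonneg _ b)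
  rw [experiment_eq]
  refine (toOuterMeasure_bind_le _ _ (bad := {ch | 0 < sampleSum ch fun _ => 1}) (a := 0)
    (b := 0) ?_ fun ch hch => ?_).trans (by simp)
  · refine (toOuterMeasure_le_mean _ (f := fun ch => sampleSum ch fun _ => 1)
      (fun ch => sampleSum_nonneg ch fun _ => zero_le_one) fun ch hch => ?_).trans ?_
    · have hch : 0 < sampleSum ch fun _ => 1 := hch
      rw [← length_selected] at hch ⊢
      exact_mod_cast hch
    · rw [mean_sampleSum (fun b => (hp b).ge) (fun b => (hp b).le.trans zero_le_one)]
      simp [hp]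
  · refine (toOuterMeasure_bind_le _ _ (bad := ∅) (a := 0) (b := 0) (by simp)
      fun s _ => answerLaw_compl _ _ fun i t _ => h _ ?_).trans (by simp)
    have hch : ¬ 0 < sampleSum ch fun _ => 1 := hch
    rw [← length_selected, not_lt] at hch
    exact_mod_cast le_antisymm hch (Nat.cast_nonneg _)

/-- The sampled coordinates are few and separate the points that are far from the query from
the point `i₀`. -/
def GoodSample (c : Fin n → EuclideanSpace ℝ (Fin d)) (q : EuclideanSpace ℝ (Fin d))
    (ε δ : ℝ) (i₀ : Fin n) {T : ℕ} (ch : Fin T → Fin d → Bool) : Prop :=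
  (sampleSum ch fun _ => 1) ≤ 3 * T * n ∧
    ∀ j, (1 + ε) * ‖c i₀ - q‖ < ‖c j - q‖ →
      0 < (sampleSum ch fun b => (c j b - q b) ^ 2 /
        sampleProb (fun ib : Fin n × Fin d => c ib.1 ib.2) b) ∧
      (1 + ε * δ / 8) * (sampleSum ch fun b => (c i₀ b - q b) ^ 2 /
        sampleProb (fun ib : Fin n × Fin d => c ib.1 ib.2) b) ≤
      sampleSum ch fun b => (c j b - q b) ^ 2 /
        sampleProb (fun ib : Fin n × Fin d => c ib.1 ib.2) b

theorem goodSample_compl (c : Fin n → EuclideanSpace ℝ (Fin d))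
    (q : EuclideanSpace ℝ (Fin d)) {ε δ : ℝ} (hε : 0 < ε) (hε1 : ε < 1 / 4) (hδ : 0 < δ)
    (hδ1 : δ < 1) (i₀ : Fin n) {T : ℕ} (hT : 0 < T) :
    (roundsLaw T (sampleProb fun ib : Fin n × Fin d => c ib.1 ib.2)).toOuterMeasure
      {ch | ¬ GoodSample c q ε δ i₀ ch} ≤
      ENNReal.ofReal (δ / 8 + Real.exp (-(T * n)) +
        n * Real.exp (-(T * (ε ^ 2 * δ / 1920)))) := by
  classical
  set p := sampleProb fun ib : Fin n × Fin d => c ib.1 ib.2 with hp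
  have h0 : ∀ b, 0 ≤ p b := sampleProb_nonneg _
  have h1 : ∀ b, p b ≤ 1 := sampleProb_le_one c
  set β := Real.exp (-(T * (ε ^ 2 * δ / 1920)))
  set a : Fin d → ℝ := fun b => c i₀ b - q b with ha
  let v : Fin n → Fin d → ℝ := fun j b => c j b - c i₀ b
  let Δ : Fin n → ℝ := fun j => ‖c j - q‖ ^ 2 - ‖c i₀ - q‖ ^ 2
  have hnorm : ∀ x y : EuclideanSpace ℝ (Fin d), ‖x - y‖ ^ 2 = ∑ b, (x b - y b) ^ 2 :=
    fun x y => by rw [EuclideanSpace.real_norm_sq_eq]; rfl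
  have hΔ : ∀ j, ∑ b, (2 * a b * v j b + v j b ^ 2) = Δ j := by
    intro j
    simp only [Δ, hnorm, ← Finset.sum_sub_distrib]
    exact Finset.sum_congr rfl fun b _ => by simp only [a, v]; ring
  have hα : ∑ b, a b ^ 2 = ‖c i₀ - q‖ ^ 2 := (hnorm _ _).symm
  have hfar : ∀ j, (1 + ε) * ‖c i₀ - q‖ < ‖c j - q‖ →
      0 < ‖c j - c i₀‖ ^ 2 ∧ 0 < Δ j ∧ 2 * (ε * ∑ b, a b ^ 2) ≤ Δ j ∧
        ε * ‖c j - c i₀‖ ^ 2 ≤ 3 * Δ j := by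
    intro j hj
    have hs : 0 ≤ ‖c i₀ - q‖ := norm_nonneg _
    have hd := mul_nonneg hε.le hs
    have htri : ‖c j - c i₀‖ ≤ ‖c j - q‖ + ‖c i₀ - q‖ := by
      rw [← sub_sub_sub_cancel_right _ _ q]
      exact norm_sub_le _ _
    have hne : c j ≠ c i₀ := by
      intro h
      rw [h] at hj
      linarith
    have hpos : 0 < ‖c j - c i₀‖ := norm_pos_iff.2 (sub_ne_zero.2 hne)
    have hsq : ‖c j - c i₀‖ ^ 2 ≤ (‖c j - q‖ + ‖c i₀ - q‖) ^ 2 :=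
      pow_le_pow_left₀ hpos.le htri 2
    simp only [Δ, hα]
    generalize ‖c j - q‖ = y at *
    generalize ‖c i₀ - q‖ = z at *
    have hyz : 0 < y - z := by linarith
    have hsum : 0 < y + z := by linarith
    refine ⟨by positivity, ?_, ?_, ?_⟩
    · have := mul_pos hyz hsum
      linarith
    · have : ε * z * (2 * z) ≤ (y - z) * (y + z) :=
        mul_le_mul (by linarith) (by linarith) (by linarith) hyz.le
      linarith
    -- Write `y + z = (y - z) + 2z` and use `εz < y - z` and `ε < 1`.
    · have h3 : ε * (y + z) ≤ 3 * (y - z) := by nlinarith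
      have h4 := mul_le_mul_of_nonneg_right h3 hsum.le
      have h5 := mul_le_mul_of_nonneg_left hsq hε.le
      linarith
  let N : Set (Fin T → Fin d → Bool) :=
    {ch | 8 / δ * (T * ∑ b, a b ^ 2) < sampleSum ch fun b => a b ^ 2 / p b}
  let Z : Fin n → Set (Fin T → Fin d → Bool) := fun j =>
    {ch | (1 + ε) * ‖c i₀ - q‖ < ‖c j - q‖ ∧ (sampleSum ch fun b =>
      (2 * a b * v j b + v j b ^ 2 + ε * δ / 16 * a b ^ 2) / p b) ≤ 3 / 4 * (T * Δ j)}
  let I : Set (Fin T → Fin d → Bool) := {ch | 3 * T * n < sampleSum ch fun _ => 1}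
  have hZ : ∀ j, (roundsLaw T p).toOuterMeasure (Z j) ≤ ENNReal.ofReal β := by
    intro j
    by_cases hj : (1 + ε) * ‖c i₀ - q‖ < ‖c j - q‖
    · obtain ⟨hV, -, haΔ, hVΔ⟩ := hfar j hj
      exact ((roundsLaw T p).toOuterMeasure.mono fun ch hch => hch.2).trans
        (gap_tail h0 h1 a (v j) hε hδ hδ1 (hnorm _ _).symm hV
          (fun b => sq_sub_le_sampleProb c b j i₀) (hΔ j) haΔ hVΔ)
    · simp [Z, hj]
  have hsub : {ch : Fin T → Fin d → Bool | ¬ GoodSample c q ε δ i₀ ch} ⊆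
      (N ∪ I) ∪ ⋃ j, Z j := by
    intro ch hch
    by_contra hc
    simp only [Set.mem_union, Set.mem_iUnion, not_or, not_exists] at hc
    obtain ⟨⟨hN, hI⟩, hZ⟩ := hc
    refine hch ⟨not_lt.1 hI, fun j hj => ?_⟩
    obtain ⟨hV, hΔ0, haΔ, hVΔ⟩ := hfar j hj
    have := gap_sampled (v := v j) h0 hε hδ hT hΔ0 haΔ (not_lt.1 hN)
      (not_le.1 fun h => hZ j ⟨hj, h⟩)
    have e : ∀ b, a b + v j b = c j b - q b := fun b => by simp only [a, v]; ring
    simpa only [e] using this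
  have hβ : 0 ≤ β := (Real.exp_pos _).le
  calc (roundsLaw T p).toOuterMeasure {ch | ¬ GoodSample c q ε δ i₀ ch}
      ≤ (roundsLaw T p).toOuterMeasure ((N ∪ I) ∪ ⋃ j, Z j) :=
        (roundsLaw T p).toOuterMeasure.mono hsub
    _ ≤ (roundsLaw T p).toOuterMeasure (N ∪ I) +
        (roundsLaw T p).toOuterMeasure (⋃ j, Z j) :=
        MeasureTheory.measure_union_le (μ := (roundsLaw T p).toOuterMeasure) _ _
    _ ≤ (ENNReal.ofReal (δ / 8) + ENNReal.ofReal (Real.exp (-(T * n)))) +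
        ∑ _j : Fin n, ENNReal.ofReal β := by
        refine add_le_add
          ((MeasureTheory.measure_union_le (μ := (roundsLaw T p).toOuterMeasure) _ _).trans
            (add_le_add (sampled_norm_tail h0 h1 a hδ hT)
              (size_tail h0 h1 (sum_sampleProb_le c))))
          ((MeasureTheory.measure_iUnion_fintype_le _ _).trans
            (Finset.sum_le_sum fun j _ => hZ j))
    _ = _ := by
        rw [Finset.sum_const, Finset.card_univ, Fintype.card_fin, nsmul_eq_mul,
          ← ENNReal.ofReal_natCast, ← ENNReal.ofReal_mul (by positivity),
          ← ENNReal.ofReal_add (by positivity) (by positivity),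
          ← ENNReal.ofReal_add (by positivity) (by positivity)]

theorem experiment_compl [NeZero n] (c : Fin n → EuclideanSpace ℝ (Fin d))
    (q : EuclideanSpace ℝ (Fin d)) {ε δ : ℝ} (hε : 0 < ε) (hε1 : ε < 1 / 4) (hδ : 0 < δ)
    (hδ1 : δ < 1) {T m : ℕ} (hT : 0 < T) (hm : 0 < m)
    {S : Set (DataStructure n d m × Outcome (Fin n))}
    (hS : ∀ ω, (ω.1.size : ℝ) ≤ 3 * T * n → ω.2.probes = ω.1.size →
      IsApproxNearest (1 + ε) c q ω.2.value → ω ∈ S) :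
    (experiment T m c q).toOuterMeasure Sᶜ ≤ ENNReal.ofReal
      (δ / 8 + Real.exp (-(T * n)) + n * Real.exp (-(T * (ε ^ 2 * δ / 1920))) +
        (n + 1) * Real.exp (-(m * (ε * δ / 32) ^ 2 / 32))) := by
  obtain ⟨i₀, -, hi₀⟩ := Finset.exists_min_image Finset.univ (fun i => ‖c i - q‖)
    ⟨(0 : Fin n), Finset.mem_univ _⟩
  rw [experiment_eq, ENNReal.ofReal_add (by positivity) (by positivity)]
  refine toOuterMeasure_bind_le _ _ (goodSample_compl c q hε hε1 hδ hδ1 i₀ hT)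
    fun ch hch => ?_
  obtain ⟨hsize, hgap⟩ := not_not.1 hch
  have hp := sampleProb_nonneg fun ib : Fin n × Fin d => c ib.1 ib.2
  set z : Fin n → Fin (selected ch).length → ℝ := fun i j =>
    (c i ((selected ch).get j) - q ((selected ch).get j)) /
      Real.sqrt (sampleProb (fun ib : Fin n × Fin d => c ib.1 ib.2) ((selected ch).get j))
    with hz
  have hzsum : ∀ i, ∑ j, z i j ^ 2 = sampleSum ch fun b => (c i b - q b) ^ 2 /
      sampleProb (fun ib : Fin n × Fin d => c ib.1 ib.2) b := fun i =>
    sum_sq_div_sqrt hp ch fun b => c i b - q b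
  have hεδ : 0 < ε * δ := mul_pos hε hδ
  have hεδ1 : ε * δ < 1 := by nlinarith
  -- Chosen so that `1 + 4θ` is the ratio `1 + εδ/8` left by the sampling.
  have hcomp := sign_compare (m := m) (z i₀) z (θ := ε * δ / 32) (by positivity) (by linarith)
    (far := {j | (1 + ε) * ‖c i₀ - q‖ < ‖c j - q‖})
    (fun i hi => by rw [hzsum]; exact (hgap i hi).1)
    (fun i hi => by
      rw [hzsum, hzsum]
      have e : 1 + 4 * (ε * δ / 32) = 1 + ε * δ / 8 := by ring
      rw [e]
      exact (hgap i hi).2)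
  refine (toOuterMeasure_bind_le _ _ hcomp (b := 0) fun s hs => ?_).trans_eq (add_zero _)
  refine answerLaw_compl _ _ fun i t hmin => hS _ ?_ rfl ?_
  · exact (length_selected ch).trans_le hsize
  · have hi : ‖c i - q‖ ≤ (1 + ε) * ‖c i₀ - q‖ := by
      by_contra hfar
      refine hs ⟨i, not_le.1 hfar, ?_⟩
      have h := hmin i₀
      rw [estimate_buildData, estimate_buildData] at h
      have hm' : (0 : ℝ) < 1 / m := by positivity
      exact le_of_mul_le_mul_left h hm'
    intro j
    simp only [dist_comm q, dist_eq_norm]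
    exact hi.trans (by gcongr; exact hi₀ j (Finset.mem_univ j))

end Combination

/-! ### Choice of constants and size bounds -/

section Constants

theorem exp_log_le {n : ℕ} (hn : 2 ≤ n) {δ y : ℝ} (hδ : 0 < δ) (hδ1 : δ < 1)
    (hy : 4 * Real.log (n / δ) ≤ y) : (n + 1) * Real.exp (-y) ≤ δ / 4 := by
  have hn' : (2 : ℝ) ≤ n := by exact_mod_cast hn
  have h1 : Real.exp (-y) ≤ (δ / n) ^ 4 := by
    calc _ ≤ Real.exp (4 * -Real.log (n / δ)) := Real.exp_le_exp.2 (by linarith)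
      _ = (δ / n) ^ 4 := by
        rw [← Real.log_inv, inv_div]
        have := Real.exp_nat_mul (Real.log (δ / n)) 4
        rw [Real.exp_log (by positivity)] at this
        exact_mod_cast this
  have h2 : δ / n ≤ 1 / 2 := by
    rw [div_le_iff₀ (by positivity)]
    linarith
  calc _ ≤ (n + n) * (δ / n) ^ 4 := by gcongr; linarith
    _ = 2 * δ * (δ / n) ^ 3 := by field_simp; ring
    _ ≤ 2 * δ * (1 / 2) ^ 3 := by gcongr
    _ = δ / 4 := by ring

theorem ceil_le_two_mul {y : ℝ} (hy : 1 ≤ y) : (⌈y⌉₊ : ℝ) ≤ 2 * y := by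
  have := (Nat.ceil_lt_add_one (zero_le_one.trans hy)).le
  linarith

theorem size_le_log {d : ℕ} (hd : 2 ≤ d) : (Nat.size d : ℝ) ≤ 4 * Real.log d := by
  have h1 : 2 ^ (Nat.size d - 1) ≤ d := by
    rw [← Nat.lt_size]
    have : 0 < Nat.size d := Nat.size_pos.2 (by omega)
    omega
  have h2 : ((Nat.size d - 1 : ℕ) : ℝ) * Real.log 2 ≤ Real.log d := by
    rw [← Real.log_pow]
    exact Real.log_le_log (by positivity) (by exact_mod_cast h1)
  have h3 : (Nat.size d : ℝ) ≤ ((Nat.size d - 1 : ℕ) : ℝ) + 1 := by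
    exact_mod_cast (by omega : Nat.size d ≤ Nat.size d - 1 + 1)
  have h4 : Real.log 2 ≤ Real.log d := Real.log_le_log (by norm_num) (by exact_mod_cast hd)
  nlinarith [Real.log_two_gt_d9, Nat.cast_nonneg (α := ℝ) (Nat.size d - 1)]

/-- Here `E = 1/ε`, `F = 1/δ`, `L = log (n/δ)`, `l = log d`. The matrix term `m * s` dictates `L² E⁶
F⁴`; factors missing from a term are inserted at the cost of a constant, since both logarithms are
at least `1/2`. -/
theorem words_polynomial_le {A B n L l E F s m w : ℝ} (hA : 0 ≤ A) (hB : 0 ≤ B) (hn : 0 ≤ n)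
    (hL : 1 / 2 ≤ L) (hl : 1 / 2 ≤ l) (hE : 1 ≤ E) (hF : 1 ≤ F) (hs0 : 0 ≤ s) (hw0 : 0 ≤ w)
    (hs : s ≤ 6 * A * (n * L * (E ^ 4 * F ^ 2)))
    (hm : m ≤ 2 * B * (L * (E ^ 2 * F ^ 2))) (hw : w ≤ 4 * l) :
    s * w + s + m * s + n * m ≤
      100 * (A + 1) * (B + 1) * (n * L ^ 2 * l * (E ^ 6 * F ^ 4)) := by
  set X := n * L ^ 2 * l * (E ^ 6 * F ^ 4) with hX
  have hL0 : 0 ≤ L := by linarith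
  have hl0 : 0 ≤ l := by linarith
  have hE2 : 1 ≤ E ^ 2 := one_le_pow₀ hE
  have hF2 : 1 ≤ F ^ 2 := one_le_pow₀ hF
  have hX0 : 0 ≤ X := by positivity
  have e1 : n * L * (E ^ 4 * F ^ 2) * l ≤ 2 * X := by
    have : 1 ≤ 2 * L * (E ^ 2 * F ^ 2) :=
      one_le_mul_of_one_le_of_one_le (by linarith) (one_le_mul_of_one_le_of_one_le hE2 hF2)
    calc _ ≤ n * L * (E ^ 4 * F ^ 2) * l * (2 * L * (E ^ 2 * F ^ 2)) :=
          le_mul_of_one_le_right (by positivity) this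
      _ = 2 * X := by rw [hX]; ring
  have e2 : n * L * (E ^ 4 * F ^ 2) ≤ 4 * X := by
    calc _ ≤ n * L * (E ^ 4 * F ^ 2) * (2 * l) :=
          le_mul_of_one_le_right (by positivity) (by linarith)
      _ ≤ 4 * X := by linarith
  have e3 : n * L ^ 2 * (E ^ 6 * F ^ 4) ≤ 2 * X := by
    calc _ ≤ n * L ^ 2 * (E ^ 6 * F ^ 4) * (2 * l) :=
          le_mul_of_one_le_right (by positivity) (by linarith)
      _ = 2 * X := by rw [hX]; ring
  have e4 : n * L * (E ^ 2 * F ^ 2) ≤ 4 * X := by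
    refine le_trans ?_ e2
    calc _ ≤ n * L * (E ^ 2 * F ^ 2) * E ^ 2 := le_mul_of_one_le_right (by positivity) hE2
      _ = _ := by ring
  have h1 : s * w ≤ 48 * (A * X) := by
    calc _ ≤ 6 * A * (n * L * (E ^ 4 * F ^ 2)) * (4 * l) := by gcongr
      _ = 24 * A * (n * L * (E ^ 4 * F ^ 2) * l) := by ring
      _ ≤ 24 * A * (2 * X) := by gcongr
      _ = _ := by ring
  have h2 : s ≤ 24 * (A * X) := by
    calc _ ≤ _ := hs
      _ ≤ 6 * A * (4 * X) := by gcongr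
      _ = _ := by ring
  have h3 : m * s ≤ 24 * (A * (B * X)) := by
    calc _ ≤ 2 * B * (L * (E ^ 2 * F ^ 2)) * (6 * A * (n * L * (E ^ 4 * F ^ 2))) := by gcongr
      _ = 12 * A * B * (n * L ^ 2 * (E ^ 6 * F ^ 4)) := by ring
      _ ≤ 12 * A * B * (2 * X) := by gcongr
      _ = _ := by ring
  have h4 : n * m ≤ 8 * (B * X) := by
    calc _ ≤ n * (2 * B * (L * (E ^ 2 * F ^ 2))) := by gcongr
      _ = 2 * B * (n * L * (E ^ 2 * F ^ 2)) := by ring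
      _ ≤ 2 * B * (4 * X) := by gcongr
      _ = _ := by ring
  have p1 : 0 ≤ A * X := by positivity
  have p2 : 0 ≤ B * X := by positivity
  have p3 : 0 ≤ A * (B * X) := by positivity
  linarith

end Constants

section Parameters

variable {n d : ℕ} {ε δ : ℝ}

theorem half_le_log {x : ℝ} (hx : 2 ≤ x) : 1 / 2 ≤ Real.log x := by
  have h1 := Real.log_two_gt_d9
  have h2 := Real.log_le_log (by norm_num) hx
  linarith

theorem two_le_div (hn : 2 ≤ n) (hδ : 0 < δ) (hδ1 : δ < 1) : (2 : ℝ) ≤ n / δ := by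
  have hn' : (2 : ℝ) ≤ n := by exact_mod_cast hn
  rw [le_div_iff₀ hδ]
  linarith

/-- A parameter with a large leading constant is at most twice the number rounded up. -/
theorem one_le_parameter {A e : ℝ} (hA : 2 ≤ A) (hn : 2 ≤ n) (hδ : 0 < δ) (hδ1 : δ < 1)
    (he : 0 < e) (he1 : e ≤ 1) : 1 ≤ A * Real.log (n / δ) / e := by
  have hL := half_le_log (two_le_div hn hδ hδ1)
  rw [one_le_div he]
  nlinarith

theorem failure_le (hn : 2 ≤ n) (hε : 0 < ε) (hε1 : ε < 1 / 4) (hδ : 0 < δ) (hδ1 : δ < 1) :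
    δ / 8 + Real.exp (-((rounds 7680 n ε δ : ℝ) * n)) +
      n * Real.exp (-((rounds 7680 n ε δ : ℝ) * (ε ^ 2 * δ / 1920))) +
      (n + 1) * Real.exp (-((targetDim 131072 n ε δ : ℝ) * (ε * δ / 32) ^ 2 / 32)) ≤ δ := by
  have hn' : (2 : ℝ) ≤ n := by exact_mod_cast hn
  have hL : 0 ≤ Real.log (n / δ) := by linarith [half_le_log (two_le_div hn hδ hδ1)]
  have hT : 7680 * Real.log (n / δ) / (ε ^ 4 * δ ^ 2) ≤ rounds 7680 n ε δ := Nat.le_ceil _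
  have hm : 131072 * Real.log (n / δ) / (ε ^ 2 * δ ^ 2) ≤ targetDim 131072 n ε δ :=
    Nat.le_ceil _
  generalize (rounds 7680 n ε δ : ℝ) = T at *
  generalize (targetDim 131072 n ε δ : ℝ) = m at *
  generalize hLdef : Real.log (n / δ) = L at *
  -- `7680 = 4 * 1920`; the extra `ε²δ` in the denominator of `T` is not needed here.
  have h1 : 4 * L ≤ T * (ε ^ 2 * δ / 1920) := by
    have e : 7680 * L / (ε ^ 4 * δ ^ 2) * (ε ^ 2 * δ / 1920) = 4 * L / (ε ^ 2 * δ) := by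
      field_simp; ring
    calc _ ≤ 4 * L / (ε ^ 2 * δ) := by
          refine le_div_self (by positivity) (by positivity) ?_
          exact mul_le_one₀ (pow_le_one₀ hε.le (by linarith)) hδ.le hδ1.le
      _ ≤ _ := by
          rw [← e]
          gcongr
  have hT0 : 0 ≤ T := le_trans (by positivity) hT
  have h2 : 4 * L ≤ T * n := by
    refine h1.trans (mul_le_mul_of_nonneg_left ?_ hT0)
    have : ε ^ 2 * δ ≤ 1 := mul_le_one₀ (pow_le_one₀ hε.le (by linarith)) hδ.le hδ1.le
    linarith
  -- `131072 = 4 * 32³`, with no slack.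
  have h3 : 4 * L ≤ m * (ε * δ / 32) ^ 2 / 32 := by
    have e : 131072 * L / (ε ^ 2 * δ ^ 2) * (ε * δ / 32) ^ 2 / 32 = 4 * L := by
      field_simp; ring
    rw [← e]
    gcongr
  -- Three terms of at most `δ/4` and Markov's `δ/8` leave `δ/8` to spare.
  have b1 := exp_log_le hn hδ hδ1 (hLdef ▸ h1)
  have b2 := exp_log_le hn hδ hδ1 (hLdef ▸ h2)
  have b3 := exp_log_le hn hδ hδ1 (hLdef ▸ h3)
  have p1 := Real.exp_pos (-(T * (ε ^ 2 * δ / 1920)))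
  have p2 : 0 ≤ n * Real.exp (-(T * n)) := by positivity
  linarith

theorem size_bound {A : ℝ} (hA : 2 ≤ A) (hn : 2 ≤ n) (hε : 0 < ε) (hε1 : ε < 1 / 4)
    (hδ : 0 < δ) (hδ1 : δ < 1) :
    3 * (rounds A n ε δ : ℝ) * n ≤ 6 * A * (n * Real.log (n / δ) / (ε ^ 4 * δ ^ 2)) := by
  have h := ceil_le_two_mul (one_le_parameter (e := ε ^ 4 * δ ^ 2) hA hn hδ hδ1
    (by positivity) (mul_le_one₀ (pow_le_one₀ hε.le (by linarith)) (by positivity)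
      (pow_le_one₀ hδ.le hδ1.le)))
  calc _ ≤ 3 * (2 * (A * Real.log (n / δ) / (ε ^ 4 * δ ^ 2))) * n := by
        gcongr
        exact h
    _ = _ := by ring

theorem words_bound {A B : ℝ} (hA : 2 ≤ A) (hB : 2 ≤ B) (hn : 2 ≤ n) (hd : 2 ≤ d)
    (hε : 0 < ε) (hε1 : ε < 1 / 4) (hδ : 0 < δ) (hδ1 : δ < 1)
    (D : DataStructure n d (targetDim B n ε δ))
    (hD : (D.size : ℝ) ≤ 3 * (rounds A n ε δ : ℝ) * n) :
    (D.words : ℝ) ≤ 100 * (A + 1) * (B + 1) *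
      (n * Real.log (n / δ) ^ 2 * Real.log d / (ε ^ 6 * δ ^ 4)) := by
  have hm := ceil_le_two_mul (one_le_parameter (e := ε ^ 2 * δ ^ 2) hB hn hδ hδ1
    (by positivity) (mul_le_one₀ (pow_le_one₀ hε.le (by linarith)) (by positivity)
      (pow_le_one₀ hδ.le hδ1.le)))
  have hs := hD.trans (size_bound hA hn hε hε1 hδ hδ1)
  have key := words_polynomial_le (A := A) (B := B) (n := n) (L := Real.log (n / δ))
    (l := Real.log d) (E := 1 / ε) (F := 1 / δ) (s := D.size)
    (m := targetDim B n ε δ) (w := Nat.size d) (by linarith) (by linarith) n.cast_nonneg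
    (half_le_log (two_le_div hn hδ hδ1)) (half_le_log (by exact_mod_cast hd))
    ((one_le_div hε).2 (by linarith)) ((one_le_div hδ).2 hδ1.le) (Nat.cast_nonneg _)
    (Nat.cast_nonneg _) (hs.trans_eq (by field_simp))
    (hm.trans_eq (by field_simp)) (size_le_log hd)
  rw [DataStructure.words]
  push_cast
  exact key.trans_eq (by field_simp)

end Parameters

end

end SampleNN

theorem mainTheorem2 :
    ∃ A B K : ℝ, ∃ k : ℕ, 0 < A ∧ 0 < B ∧ 0 < K ∧
      ∀ (n d : ℕ) [NeZero n] (c : Fin n → EuclideanSpace ℝ (Fin d)) (ε δ : ℝ),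
        0 < ε → ε < 1 / 4 → 0 < δ → δ < 1 →
        -- preprocessing takes polynomial time
        (∀ o ∈ (SampleNN.preprocessLaw (SampleNN.rounds A n ε δ)
              (SampleNN.targetDim B n ε δ) c).support,
            (o.steps : ℝ) ≤ K * (n + d + 1 / ε + 1 / δ) ^ k) ∧
        -- each query is answered as claimed with probability at least `1 - δ`
        ∀ q : EuclideanSpace ℝ (Fin d),
          ENNReal.ofReal (1 - δ) ≤
            (SampleNN.experiment (SampleNN.rounds A n ε δ)
              (SampleNN.targetDim B n ε δ) c q).toOuterMeasure
              {ω | (ω.2.probes : ℝ) ≤ K * (n * Real.log (n / δ) / (ε ^ 4 * δ ^ 2)) ∧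
                SampleNN.IsApproxNearest (1 + ε) c q ω.2.value ∧
                (2 ≤ n → 2 ≤ d →
                  (ω.1.words : ℝ) ≤
                    K * (n * Real.log (n / δ) ^ 2 * Real.log d / (ε ^ 6 * δ ^ 4)))} := by
  -- `K` dominates the constants for steps, `13 + 10(A+1)(B+1)`, for probes, `6A`, and for words,
  -- `100(A+1)(B+1)`.
  refine ⟨7680, 131072, 13 + 100 * (7680 + 1) * (131072 + 1), 16, by norm_num, by norm_num,
    by norm_num, ?_⟩
  intro n d _ c ε δ hε hε1 hδ hδ1
  have hn : 1 ≤ n := Nat.one_le_iff_ne_zero.2 (NeZero.ne n)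
  have hn' : (1 : ℝ) ≤ n := by exact_mod_cast hn
  have hlog : 0 ≤ Real.log (n / δ) := Real.log_nonneg ((one_le_div hδ).2 (by linarith))
  refine ⟨fun o ho => ?_, fun q => SampleNN.le_toOuterMeasure_of_compl _ hδ.le ?_⟩
  · have hsteps := (SampleNN.spec_preprocess _ _ _ o ho).1
    refine (Nat.cast_le.2 hsteps).trans ((SampleNN.steps_le (A := 7680) (B := 131072)
      (by norm_num) (by norm_num) hn hε hδ hδ1 rfl rfl).trans ?_)
    gcongr
    norm_num
  · rcases hn.eq_or_lt with h1 | h2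
    · refine le_trans (SampleNN.experiment_single h1.symm _ _ c q ?_) zero_le
      refine fun ω hω => ⟨?_, ?_, ?_⟩
      · rw [hω, Nat.cast_zero]
        positivity
      · intro j
        subst h1
        rw [Subsingleton.elim ω.2.value j]
        exact le_mul_of_one_le_left dist_nonneg (by linarith)
      · intro h
        omega
    · have hT : 0 < SampleNN.rounds 7680 n ε δ := by
        refine Nat.ceil_pos.2 (lt_of_lt_of_le one_pos (SampleNN.one_le_parameter (by norm_num)
          h2 hδ hδ1 (by positivity) ?_))
        exact mul_le_one₀ (pow_le_one₀ hε.le (by linarith)) (by positivity)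
          (pow_le_one₀ hδ.le hδ1.le)
      have hm : 0 < SampleNN.targetDim 131072 n ε δ := by
        refine Nat.ceil_pos.2 (lt_of_lt_of_le one_pos (SampleNN.one_le_parameter (by norm_num)
          h2 hδ hδ1 (by positivity) ?_))
        exact mul_le_one₀ (pow_le_one₀ hε.le (by linarith)) (by positivity)
          (pow_le_one₀ hδ.le hδ1.le)
      refine le_trans (SampleNN.experiment_compl c q hε hε1 hδ hδ1 hT hm ?_)
        (ENNReal.ofReal_le_ofReal (SampleNN.failure_le h2 hε hε1 hδ hδ1))
      refine fun ω hsize hprobes hnear => ⟨?_, hnear, fun _ hd => ?_⟩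
      · rw [hprobes]
        refine (hsize.trans (SampleNN.size_bound (by norm_num) h2 hε hε1 hδ hδ1)).trans ?_
        gcongr
        norm_num
      · have hd' : (1 : ℝ) ≤ d := by exact_mod_cast one_le_two.trans hd
        have hlogd : 0 ≤ Real.log d := Real.log_nonneg hd'
        refine (SampleNN.words_bound (by norm_num) (by norm_num) h2 hd hε hε1 hδ hδ1 _
          hsize).trans ?_
        gcongr
        norm_num
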